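/- Let $N\ge 2$ and let $M_{2N+1}$ be the Möbius ladder with $2N+1$ rungs: the graph obtained from a circle with $4N+2$ vertices by adding an edge between every pair of antipodal vertices. Denote the edges of the circle (the outer edges) consecutively by $x_1,\dots,x_{4N+2}$ and the rungs (the inner edges) by $y_1,\dots,y_{2N+1}$. Colour the vertices alternately even and odd along the circle, and orient every outer edge from its even to its odd endpoint and every rung from its odd to its even endpoint. For disjoint edges $a,b$ let $d(a,b)$ be the minimal number of edges in a path of outer edges joining an endpoint of $a$ to an endpoint of $b$, and put $$\varepsilon(x_i,x_j)=\begin{cases}2&\text{if } d(x_i,x_j)\text{ is odd and } d(x_i,x_j)\ne 2N-1,\\-1&\text{if } d(x_i,x_j)=2N,\\1&\text{otherwise,}\end{cases}$$ $$\varepsilon(x_i,y_j)=\begin{cases}2&\text{if } d(x_i,y_j)=1,\\3&\text{if } d(x_i,y_j)\ge 2,\end{cases}\qquad \varepsilon(y_i,y_j)=\begin{cases}2&\text{if } d(y_i,y_j)=1,\\5&\text{if } d(y_i,y_j)=2,\\6&\text{if } d(y_i,y_j)\ge 3.\end{cases}$$ For an embedding $f:M_{2N+1}\to S^3$ with a regular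 projection (finitely many multiple points, all of them transverse double points that are not vertices), let $\ell(f(a),f(b))$ be the sum of the signs of the crossings between $f(a)$ and $f(b)$ in the projection, and let $$\widehat L_\varepsilon(f)=\sum_{a\cap b=\emptyset}\varepsilon(a,b)\,\ell(f(a),f(b)),$$ where the sum is over all unordered pairs of disjoint edges; here $S^3\subset\mathbb R^4$ is projected to a plane by stereographic projection to $\mathbb R^3$ from $(0,0,0,1)$ followed by the vertical projection $\mathbb R^3\to\mathbb R^2$. Then for every odd integer $m$ there is an embedding $f$ of $M_{2N+1}$ in $S^3$, smooth on every edge and with a regular projection, such that $\widehat L_\varepsilon(f)=m$ and every automorphism $\alpha$ of $M_{2N+1}$ is induced by a homeomorphism of $(S^3,f(M_{2N+1}))$: there is a homeomorphism $h:S^3\to S^3$ with $h(f(M_{2N+1}))=f(M_{2N+1})$ and $h\circ f=f\circ|\alpha|$, where $|\alpha|$ is the self-homeomorphism of $M_{2N+1}$ that acts on the vertices as $\alpha$ and is linear on the edges. -/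

import Mathlib

open scoped ContDiff

noncomputable section

/-! ### Geometric realization of a graph -/

/-- The geometric realization of a finite graph, as a 1-dimensional simplicial complex in `ℝ^V`:
vertices are the standard basis vectors, edges are the segments joining adjacent ones. It carries
the subspace topology. -/
def SimpleGraph.realization {V : Type*} [DecidableEq V] (G : SimpleGraph V) : Set (V → ℝ) :=
  {p | ∃ u v, (u = v ∨ G.Adj u v) ∧ p ∈ segment ℝ (Pi.single u 1 : V → ℝ) (Pi.single v 1)}

/-- A vertex as a point of the realization. -/
def SimpleGraph.vertexPoint {V : Type*} [DecidableEq V] (G : SimpleGraph V) (v : V) :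
    G.realization :=
  ⟨Pi.single v 1, v, v, Or.inl rfl, left_mem_segment ℝ _ _⟩

/-- The point `(1 - t) u + t v` of the edge from `u` to `v`. -/
def SimpleGraph.edgePoint {V : Type*} [DecidableEq V] (G : SimpleGraph V) {u v : V}
    (huv : G.Adj u v) (t : unitInterval) : G.realization :=
  ⟨(1 - (t : ℝ)) • (Pi.single u 1 : V → ℝ) + (t : ℝ) • (Pi.single v 1 : V → ℝ),
    u, v, Or.inr huv, 1 - (t : ℝ), t, sub_nonneg.2 t.2.2, t.2.1, by ring, rfl⟩

/-- The self-map of the realization given by a graph automorphism, extended linearly over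
edges. -/
def SimpleGraph.realizationMap {V : Type*} [DecidableEq V] (G : SimpleGraph V) (α : G ≃g G)
    (p : G.realization) : G.realization :=
  ⟨fun v => (p : V → ℝ) (α.symm v), by
    obtain ⟨p, u, v, h, a, b, ha, hb, hab, rfl⟩ := p
    refine ⟨α u, α v, ?_, a, b, ha, hb, hab, ?_⟩
    · rcases h with rfl | h
      · exact Or.inl rfl
      · exact Or.inr (α.map_adj_iff.2 h)
    · have key : ∀ w x : V, (Pi.single (α w) 1 : V → ℝ) x
          = (Pi.single w 1 : V → ℝ) (α.symm x) := by
        intro w x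
        have hx : x = α w ↔ α.symm x = w := by
          constructor
          · rintro rfl; simp
          · rintro rfl; simp
        simp only [Pi.single_apply, hx]
      funext x
      simp [key]⟩

/-! ### Möbius ladders -/

namespace MobiusLadder

/-- The Möbius ladder with `n` rungs: the circle with `2n` vertices together with an edge between
every pair of antipodal vertices. -/
def graph (n : ℕ) : SimpleGraph (ZMod (2 * n)) :=
  SimpleGraph.fromRel fun u v => v = u + 1 ∨ v = u + (n : ZMod (2 * n))

/-- The circle of outer edges. -/
def outerCycle (n : ℕ) : SimpleGraph (ZMod (2 * n)) :=
  SimpleGraph.fromRel fun u v => v = u + 1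

/-- Labels for the edges of the Möbius ladder with `2N + 1` rungs: `Sum.inl i` is the outer edge
`xᵢ` joining the vertices `i` and `i + 1`, and `Sum.inr j` is the inner edge (rung) `yⱼ` joining
the vertices `j` and `j + 2N + 1`. Indices start at `0`. -/
abbrev Edge (N : ℕ) : Type := Fin (2 * (2 * N + 1)) ⊕ Fin (2 * N + 1)

/-- Position of an edge in the list `x₀, x₁, …, y₀, y₁, …`, used to list every unordered pair of
edges once. -/
def Edge.index {N : ℕ} : Edge N → ℕ
  | Sum.inl i => i
  | Sum.inr j => 2 * (2 * N + 1) + j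

/-- Initial vertex. Vertices alternate between even and odd along the circle; outer edges are
directed from even to odd, rungs from odd to even. Thus at every vertex either both outer edges
point in and the rung points out, or both outer edges point out and the rung points in. -/
def Edge.src {N : ℕ} : Edge N → ZMod (2 * (2 * N + 1))
  | Sum.inl i => if Even (i : ℕ) then ((i : ℕ) : ZMod _) else ((i : ℕ) : ZMod _) + 1
  | Sum.inr j => if Even (j : ℕ) then ((j : ℕ) : ZMod _) + ((2 * N + 1 : ℕ) : ZMod _)
      else ((j : ℕ) : ZMod _)

/-- Terminal vertex. -/
def Edge.tgt {N : ℕ} : Edge N → ZMod (2 * (2 * N + 1))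
  | Sum.inl i => if Even (i : ℕ) then ((i : ℕ) : ZMod _) + 1 else ((i : ℕ) : ZMod _)
  | Sum.inr j => if Even (j : ℕ) then ((j : ℕ) : ZMod _)
      else ((j : ℕ) : ZMod _) + ((2 * N + 1 : ℕ) : ZMod _)

theorem Edge.adj {N : ℕ} (a : Edge N) : (graph (2 * N + 1)).Adj a.src a.tgt := by
  have h1 : ((1 : ℕ) : ZMod (2 * (2 * N + 1))) ≠ 0 := by
    rw [Ne, ZMod.natCast_eq_zero_iff]
    intro h
    have := Nat.le_of_dvd (by omega) h
    omega
  have h2 : ((2 * N + 1 : ℕ) : ZMod (2 * (2 * N + 1))) ≠ 0 := by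
    rw [Ne, ZMod.natCast_eq_zero_iff]
    intro h
    have := Nat.le_of_dvd (by omega) h
    omega
  rw [Nat.cast_one] at h1
  rcases a with i | j
  · by_cases h : Even (i : ℕ) <;>
      simp only [graph, Edge.src, Edge.tgt, h, if_true, if_false, SimpleGraph.fromRel_adj] <;>
      simp [h1]
  · by_cases h : Even (j : ℕ) <;>
      simp only [graph, Edge.src, Edge.tgt, h, if_true, if_false, SimpleGraph.fromRel_adj] <;>
      refine ⟨by simpa using h2, ?_⟩ <;> simp

/-- Two edges are disjoint if they share no vertex. -/
def Edge.IsDisjoint {N : ℕ} (a b : Edge N) : Prop :=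
  a.src ≠ b.src ∧ a.src ≠ b.tgt ∧ a.tgt ≠ b.src ∧ a.tgt ≠ b.tgt

instance {N : ℕ} (a b : Edge N) : Decidable (a.IsDisjoint b) :=
  inferInstanceAs (Decidable (_ ∧ _ ∧ _ ∧ _))

/-- The minimal outer edge distance of two disjoint edges: the least number of edges of a path of
outer edges from an endpoint of `a` to an endpoint of `b`. -/
def outerDist {N : ℕ} (a b : Edge N) : ℕ :=
  min (min ((outerCycle (2 * N + 1)).dist a.src b.src) ((outerCycle (2 * N + 1)).dist a.src b.tgt))
    (min ((outerCycle (2 * N + 1)).dist a.tgt b.src) ((outerCycle (2 * N + 1)).dist a.tgt b.tgt))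

/-- The epsilon coefficient of a pair of disjoint edges. -/
def epsilon {N : ℕ} (a b : Edge N) : ℤ :=
  match a, b with
  | Sum.inl _, Sum.inl _ =>
      if Odd (outerDist a b) ∧ outerDist a b ≠ 2 * N - 1 then 2
      else if outerDist a b = 2 * N then -1
      else 1
  | Sum.inl _, Sum.inr _ => if outerDist a b = 1 then 2 else 3
  | Sum.inr _, Sum.inl _ => if outerDist a b = 1 then 2 else 3
  | Sum.inr _, Sum.inr _ =>
      if outerDist a b = 1 then 2 else if outerDist a b = 2 then 5 else 6

end MobiusLadder

/-! ### Projections of spatial Möbius ladders -/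

/-- The 3-sphere. -/
abbrev Sphere3 : Type := Metric.sphere (0 : EuclideanSpace ℝ (Fin 4)) 1

namespace Sphere3

/-- The shadow of a point of `S³` (other than the pole `(0,0,0,1)`) in the plane of projection:
stereographic projection to `ℝ³` from the pole, followed by `(X, Y, Z) ↦ (X, Y)`. -/
def shadow (q : Sphere3) : ℝ × ℝ :=
  ((q : EuclideanSpace ℝ (Fin 4)) 0 / (1 - (q : EuclideanSpace ℝ (Fin 4)) 3),
    (q : EuclideanSpace ℝ (Fin 4)) 1 / (1 - (q : EuclideanSpace ℝ (Fin 4)) 3))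

/-- The height of a point of `S³` (other than the pole) over the plane of projection: the
coordinate `Z` of its stereographic projection. -/
def height (q : Sphere3) : ℝ :=
  (q : EuclideanSpace ℝ (Fin 4)) 2 / (1 - (q : EuclideanSpace ℝ (Fin 4)) 3)

end Sphere3

namespace MobiusLadder

/-- The Möbius ladder with `2N + 1` rungs as a topological space. -/
abbrev Space (N : ℕ) : Type := (graph (2 * N + 1)).realization

/-- The point at parameter `t ∈ [0,1]` of the oriented edge `a` (for `t` outside of `[0,1]`, the
nearer endpoint of `a`). -/
def Edge.point {N : ℕ} (a : Edge N) (t : ℝ) : Space N :=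
  (graph (2 * N + 1)).edgePoint a.adj (Set.projIcc 0 1 zero_le_one t)

/-- The planar cross product of two vectors. -/
def cross (v w : ℝ × ℝ) : ℝ := v.1 * w.2 - v.2 * w.1

/-- The plane curve traced by the projection of the edge `a`. -/
def edgeShadow {N : ℕ} (f : Space N → Sphere3) (a : Edge N) (t : ℝ) : ℝ × ℝ :=
  (f (a.point t)).shadow

/-- The height along the edge `a`. -/
def edgeHeight {N : ℕ} (f : Space N → Sphere3) (a : Edge N) (t : ℝ) : ℝ :=
  (f (a.point t)).height

/-- `f` has a regular projection: it misses the centre of projection, edges are smooth arcs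
whose projections are immersed, there are only finitely many multiple points, all of which are
double points that are not (projections of) vertices and at which the two branches cross
transversally. -/
structure HasRegularProjection {N : ℕ} (f : Space N → Sphere3) : Prop where
  ne_pole : ∀ p, (f p : EuclideanSpace ℝ (Fin 4)) 3 ≠ 1
  smooth_shadow : ∀ a : Edge N, ContDiffOn ℝ ∞ (edgeShadow f a) (Set.Icc 0 1)
  smooth_height : ∀ a : Edge N, ContDiffOn ℝ ∞ (edgeHeight f a) (Set.Icc 0 1)
  immersed : ∀ a : Edge N, ∀ t ∈ Set.Icc (0 : ℝ) 1,
    derivWithin (edgeShadow f a) (Set.Icc 0 1) t ≠ 0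
  finite_multiple :
    {pq : Space N × Space N | pq.1 ≠ pq.2 ∧ (f pq.1).shadow = (f pq.2).shadow}.Finite
  no_triple : ∀ p q r : Space N, (f p).shadow = (f q).shadow → (f q).shadow = (f r).shadow →
    p = q ∨ q = r ∨ p = r
  vertex_simple : ∀ (v : ZMod (2 * (2 * N + 1))) (q : Space N),
    (f ((graph (2 * N + 1)).vertexPoint v)).shadow = (f q).shadow →
      (graph (2 * N + 1)).vertexPoint v = q
  transverse : ∀ a b : Edge N, ∀ s ∈ Set.Ioo (0 : ℝ) 1, ∀ t ∈ Set.Ioo (0 : ℝ) 1,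
    a.point s ≠ b.point t → edgeShadow f a s = edgeShadow f b t →
      cross (deriv (edgeShadow f a) s) (deriv (edgeShadow f b) t) ≠ 0

/-- The crossings between the projections of the edges `a` and `b`, as pairs of parameters. -/
def crossings {N : ℕ} (f : Space N → Sphere3) (a b : Edge N) : Set (ℝ × ℝ) :=
  {st | st.1 ∈ Set.Ioo (0 : ℝ) 1 ∧ st.2 ∈ Set.Ioo (0 : ℝ) 1 ∧
    edgeShadow f a st.1 = edgeShadow f b st.2}

/-- The sign of a crossing: the sign of the planar cross product of the direction of the upper
strand with the direction of the lower strand. -/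
def crossingSign {N : ℕ} (f : Space N → Sphere3) (a b : Edge N) (st : ℝ × ℝ) : ℤ :=
  if edgeHeight f b st.2 < edgeHeight f a st.1 then
    (SignType.sign (cross (deriv (edgeShadow f a) st.1) (deriv (edgeShadow f b) st.2)) : ℤ)
  else
    (SignType.sign (cross (deriv (edgeShadow f b) st.2) (deriv (edgeShadow f a) st.1)) : ℤ)

/-- `ℓ(f(a), f(b))`: the sum of the signs of the crossings between `f(a)` and `f(b)`. -/
def signedCrossings {N : ℕ} (f : Space N → Sphere3) (a b : Edge N) : ℤ :=
  ∑ᶠ st ∈ crossings f a b, crossingSign f a b st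

/-- The generalized Simon invariant of an embedding with a regular projection: the sum of
`ε(a,b) ℓ(f(a), f(b))` over all unordered pairs of disjoint edges. -/
def simonInvariant {N : ℕ} (f : Space N → Sphere3) : ℤ :=
  ∑ ab : Edge N × Edge N with ab.1.index < ab.2.index ∧ ab.1.IsDisjoint ab.2,
    epsilon ab.1 ab.2 * signedCrossings f ab.1 ab.2

/-- The automorphism `α` is induced by a homeomorphism `h` of the pair `(S³, f(M))`: `h` maps
`f(M)` onto itself and acts on it as `α` does. -/
def IsInducedBy {N : ℕ} (f : Space N → Sphere3) (α : graph (2 * N + 1) ≃g graph (2 * N + 1))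
    (h : Sphere3 ≃ₜ Sphere3) : Prop :=
  h '' Set.range f = Set.range f ∧
    ∀ p, h (f p) = f ((graph (2 * N + 1)).realizationMap α p)

end MobiusLadder

end

namespace MobiusLadder

/-! ### Automorphisms of Möbius ladders -/

/-! Put n = 2N + 1 and let a be odd. In S³ ⊆ ℂ², thicken the unknotted circle in the first
coordinate to a ribbon whose cross section turns at constant speed by a half twists per revolution.
Since a is odd, this is a Möbius band: its boundary is one circle, used as the outer circle of the
ladder, and n equally spaced cross sections serve as rungs.

Symmetry: both angles of a ribbon point are affine functions of the parameter u. Hence every shift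
of u is a rotation of S³ in the two complex coordinates, and every reflection of u is complex
conjugation followed by such a rotation. With at least four rungs the ladder has no automorphisms
besides the rotations and reflections of its outer circle (`aut_eq`), so all of them are induced
(`exists_isInducedBy`).

Invariant: two points of the ladder share a shadow only where the ribbon is vertical, and then they
are the boundary points at u and u + n (`eq_or_crossing`). So only antipodal outer edges cross, and
these have coefficient -1; the other coefficients never matter. All crossings have the sign of a
(`crossingSign_antipodal`), and the number on each antipodal pair is a difference of floors that
telescopes to |a| in total. The invariant is therefore -a (`simonInvariant_eq`), and a = -m gives
the theorem.

Regularity of the projection depends on two choices. A phase offset in `twist` keeps the ribbon from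
being vertical at a rung, and a small half width ψ₀ makes the shadow of each rung an immersed radial
segment (`IsAdmissible`). -/

theorem intCast_ne_zero_of_abs_lt {n : ℕ} {c : ℤ} (h0 : c ≠ 0) (h : |c| < 2 * n) :
    (c : ZMod (2 * n)) ≠ 0 := by
  rw [Ne, ZMod.intCast_zmod_eq_zero_iff_dvd]
  intro hd
  have := Int.eq_zero_of_abs_lt_dvd hd (by push_cast; exact h)
  exact h0 this

theorem natCast_add_self (n : ℕ) : (n : ZMod (2 * n)) + n = 0 := by
  have := ZMod.natCast_self (2 * n)
  push_cast at this
  linear_combination this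

theorem graph_adj_iff {n : ℕ} (hn : 2 ≤ n) {u v : ZMod (2 * n)} :
    (graph n).Adj u v ↔ v = u + 1 ∨ v = u - 1 ∨ v = u + n := by
  have h1 : ((1 : ℤ) : ZMod (2 * n)) ≠ 0 :=
    intCast_ne_zero_of_abs_lt (by omega) (by rw [abs_lt]; omega)
  have h2 : ((n : ℤ) : ZMod (2 * n)) ≠ 0 :=
    intCast_ne_zero_of_abs_lt (by omega) (by rw [abs_lt]; omega)
  push_cast at h1 h2
  have h3 := natCast_add_self n
  rw [graph, SimpleGraph.fromRel_adj]
  constructor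
  · rintro ⟨-, (h | h) | (h | h)⟩
    · exact Or.inl h
    · exact Or.inr (Or.inr h)
    · exact Or.inr (Or.inl (by rw [h]; ring))
    · exact Or.inr (Or.inr (by rw [h]; linear_combination -h3))
  · rintro (rfl | rfl | rfl)
    · exact ⟨by simpa using h1, by simp⟩
    · exact ⟨fun h => h1 (by linear_combination h), by simp⟩
    · exact ⟨by simpa using h2, by simp⟩

/-- Any other common neighbour would make 4, 3 - n, n + 3 or 2 vanish modulo 2n. For n = 3, where
the graph is K₃,₃, this does happen. -/
theorem eq_of_adj_of_adj {n : ℕ} (hn : 4 ≤ n) {u x : ZMod (2 * n)}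
    (h1 : (graph n).Adj (u + 1) x) (h2 : (graph n).Adj (u - 1) x) : x = u := by
  rw [graph_adj_iff (by omega)] at h1 h2
  have key : ∀ c : ℤ, c ≠ 0 → |c| < 2 * n → (c : ZMod (2 * n)) = 0 → x = u :=
    fun c h0 h h' => absurd h' (intCast_ne_zero_of_abs_lt h0 h)
  rcases h1 with h1 | h1 | h1
  · rcases h2 with h2 | h2 | h2
    · rw [h2]; ring
    · refine key 4 (by omega) (by rw [abs_lt]; omega) ?_
      push_cast; linear_combination h2 - h1
    · refine key (3 - n) (by omega) (by rw [abs_lt]; omega) ?_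
      push_cast; linear_combination h2 - h1
  · rw [h1]; ring
  · rcases h2 with h2 | h2 | h2
    · rw [h2]; ring
    · refine key (n + 3) (by omega) (by rw [abs_lt]; omega) ?_
      push_cast; linear_combination h2 - h1
    · refine key 2 (by omega) (by rw [abs_lt]; omega) ?_
      push_cast; linear_combination h2 - h1

/-- Outer and rung neighbours of a vertex w are told apart by common neighbours: w ± 1 and w + n are
both adjacent to w ± 1 + n, whereas u + 1 and u - 1 have only u in common. So α cannot send an outer
neighbour of u to the rung neighbour of its image. -/
theorem aut_outer {n : ℕ} (hn : 4 ≤ n) (α : graph n ≃g graph n) (u : ZMod (2 * n)) :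
    (α (u + 1) = α u + 1 ∨ α (u + 1) = α u - 1) ∧ α (u + 1) + α (u - 1) = 2 * α u := by
  have adj : ∀ {x y}, (graph n).Adj x y ↔ y = x + 1 ∨ y = x - 1 ∨ y = x + n :=
    graph_adj_iff (by omega)
  have h3 := natCast_add_self n
  have hA : (graph n).Adj (α u) (α (u + 1)) := α.map_adj_iff.2 (adj.2 (by simp))
  have hB : (graph n).Adj (α u) (α (u - 1)) := α.map_adj_iff.2 (adj.2 (by simp))
  have hAB : α (u + 1) ≠ α (u - 1) := by
    intro h
    have h' := α.injective h
    refine intCast_ne_zero_of_abs_lt (n := n) (c := 2) (by omega) (by rw [abs_lt]; omega) ?_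
    push_cast; linear_combination h'
  have common : ∀ y, (graph n).Adj (α (u + 1)) y → (graph n).Adj (α (u - 1)) y → y = α u := by
    intro y h1 h2
    have := eq_of_adj_of_adj hn (u := u) (x := α.symm y)
      (α.map_adj_iff.1 (by simpa using h1)) (α.map_adj_iff.1 (by simpa using h2))
    rw [← this]; simp
  have nn : ∀ x : ZMod (2 * n), x + n ≠ x := fun x h =>
    intCast_ne_zero_of_abs_lt (n := n) (c := n) (by omega) (by rw [abs_lt]; omega)
      (by push_cast; linear_combination h)
  have n1 : ∀ x : ZMod (2 * n), x + 1 + n ≠ x := fun x h =>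
    intCast_ne_zero_of_abs_lt (n := n) (c := n + 1) (by omega) (by rw [abs_lt]; omega)
      (by push_cast; linear_combination h)
  have n2 : ∀ x : ZMod (2 * n), x - 1 + n ≠ x := fun x h =>
    intCast_ne_zero_of_abs_lt (n := n) (c := n - 1) (by omega) (by rw [abs_lt]; omega)
      (by push_cast; linear_combination h)
  rw [adj] at hA hB
  generalize α (u + 1) = A at *
  generalize α (u - 1) = B at *
  generalize α u = w at *
  rcases hA with rfl | rfl | rfl <;> rcases hB with rfl | rfl | rfl
  · exact absurd rfl hAB
  · exact ⟨by simp, by ring⟩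
  · exact absurd (common (w + 1 + n) (adj.2 (by simp)) (adj.2 (Or.inl (by ring)))) (n1 w)
  · exact ⟨by simp, by ring⟩
  · exact absurd rfl hAB
  · exact absurd (common (w - 1 + n) (adj.2 (by simp)) (adj.2 (Or.inr (Or.inl (by ring))))) (n2 w)
  · exact absurd (common (w + 1 + n) (adj.2 (Or.inl (by ring))) (adj.2 (by simp))) (n1 w)
  · exact absurd (common (w - 1 + n) (adj.2 (Or.inr (Or.inl (by ring)))) (adj.2 (by simp))) (n2 w)
  · exact absurd rfl hAB

/-- Every automorphism of a Möbius ladder with at least four rungs is a rotation or a reflection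
of the outer circle. -/
theorem aut_eq {n : ℕ} (hn : 4 ≤ n) (α : graph n ≃g graph n) :
    ∃ c : ℤ, (∀ k : ℤ, α k = ((k + c : ℤ) : ZMod (2 * n))) ∨
      ∀ k : ℤ, α k = ((c - k : ℤ) : ZMod (2 * n)) := by
  obtain ⟨c, hc⟩ := ZMod.intCast_surjective (α 0)
  have key : ∀ e : ZMod (2 * n), α 1 = α 0 + e → ∀ k : ℕ, α k = α 0 + e * k := by
    intro e he k
    -- The second difference of α vanishes, a two-step recursion, so the induction carries two
    -- consecutive values.
    suffices α k = α 0 + e * k ∧ α (k + 1) = α 0 + e * (k + 1) from this.1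
    induction k with
    | zero => simp [he]
    | succ k ih =>
      refine ⟨by push_cast; exact ih.2, ?_⟩
      have := (aut_outer hn α (k + 1 : ZMod (2 * n))).2
      rw [add_sub_cancel_right, ih.1, ih.2] at this
      push_cast
      linear_combination this
  have toInt : ∀ e : ZMod (2 * n), α 1 = α 0 + e → ∀ k : ℤ, α k = α 0 + e * k := by
    intro e he k
    have : NeZero (2 * n) := ⟨by omega⟩
    have := key e he (k : ZMod (2 * n)).val
    simpa using this
  refine ⟨c, ?_⟩
  rcases (aut_outer hn α 0).1 with h | h
  · left
    intro k
    rw [toInt 1 (by simpa using h) k, ← hc]; push_cast; ring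
  · right
    intro k
    rw [toInt (-1) (by rw [← sub_eq_add_neg]; simpa using h) k, ← hc]; push_cast; ring

/-! ### Distances along the outer circle -/

theorem outerCycle_walk_displacement {n : ℕ} {u v : ZMod (2 * n)} (p : (outerCycle n).Walk u v) :
    ∃ d : ℤ, |d| ≤ p.length ∧ v = u + d := by
  induction p with
  | nil => exact ⟨0, by simp⟩
  | cons h p ih =>
    obtain ⟨d, hd, hv⟩ := ih
    rw [outerCycle, SimpleGraph.fromRel_adj] at h
    rw [SimpleGraph.Walk.length_cons]
    rw [abs_le] at hd
    rcases h.2 with h | h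
    · exact ⟨d + 1, by rw [abs_le]; push_cast; omega, by rw [hv, h]; push_cast; ring⟩
    · exact ⟨d - 1, by rw [abs_le]; push_cast; omega, by rw [hv, h]; push_cast; ring⟩

theorem outerCycle_exists_walk {n : ℕ} (hn : 1 ≤ n) (u : ZMod (2 * n)) (k : ℕ) :
    ∃ p : (outerCycle n).Walk u (u + k), p.length = k := by
  have h1 : ((1 : ℤ) : ZMod (2 * n)) ≠ 0 :=
    intCast_ne_zero_of_abs_lt (by omega) (by rw [abs_lt]; omega)
  push_cast at h1
  induction k with
  | zero => exact ⟨SimpleGraph.Walk.nil.copy rfl (by simp), by simp⟩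
  | succ k ih =>
    obtain ⟨p, hp⟩ := ih
    have h : (outerCycle n).Adj (u + k) (u + (k + 1 : ℕ)) := by
      rw [outerCycle, SimpleGraph.fromRel_adj]
      push_cast
      refine ⟨?_, Or.inl (by ring)⟩
      rw [← add_assoc]
      simpa using h1
    exact ⟨p.concat h, by simp [hp]⟩

/-- A walk changes the position by an integer d no larger than its length. A walk shorter than k
would give k - d = 0 modulo 2n with 0 < k - d < 2n. -/
theorem outerCycle_dist {n : ℕ} (hn : 1 ≤ n) (u : ZMod (2 * n)) {k : ℕ} (hk : k ≤ n) :
    (outerCycle n).dist u (u + k) = k := by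
  obtain ⟨p, hp⟩ := outerCycle_exists_walk hn u k
  refine le_antisymm ((SimpleGraph.dist_le p).trans hp.le) ?_
  obtain ⟨q, hq⟩ := (SimpleGraph.Walk.reachable p).exists_walk_length_eq_dist
  obtain ⟨d, hd, hv⟩ := outerCycle_walk_displacement q
  rw [hq] at hd
  by_contra! hlt
  rw [abs_le] at hd
  refine intCast_ne_zero_of_abs_lt (n := n) (c := k - d) (by omega) (by rw [abs_lt]; omega) ?_
  push_cast
  linear_combination hv

/-- Of the four endpoint distances two are 2N + 1 and two are 2N; parity only decides which
endpoints are the sources. -/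
theorem outerDist_antipodal {N : ℕ} {i j : Fin (2 * (2 * N + 1))} (h : (j : ℕ) = i + (2 * N + 1)) :
    outerDist (Sum.inl i : Edge N) (Sum.inl j) = 2 * N := by
  have D := fun u k hk => outerCycle_dist (n := 2 * N + 1) (by omega) u (k := k) hk
  have h3 := natCast_add_self (2 * N + 1)
  have d1 := D (i : ℕ) (2 * N + 1) le_rfl
  have d2 := D (i + 1 : ℕ) (2 * N + 1) le_rfl
  have d3 := D (i + 1 : ℕ) (2 * N) (by omega)
  have d4 := D (j + 1 : ℕ) (2 * N) (by omega)
  rw [SimpleGraph.dist_comm] at d4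
  have e4 : ((j + 1 : ℕ) : ZMod (2 * (2 * N + 1))) + (2 * N : ℕ) = (i : ℕ) := by
    rw [h]; push_cast at h3 ⊢; linear_combination h3
  have e3 : ((i + 1 : ℕ) : ZMod (2 * (2 * N + 1))) + (2 * N : ℕ) = (j : ℕ) := by
    rw [h]; push_cast; ring
  have e2 : ((i + 1 : ℕ) : ZMod (2 * (2 * N + 1))) + (2 * N + 1 : ℕ) = (j : ℕ) + 1 := by
    rw [h]; push_cast; ring
  have e1 : ((i : ℕ) : ZMod (2 * (2 * N + 1))) + (2 * N + 1 : ℕ) = (j : ℕ) := by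
    rw [h]; push_cast; ring
  rw [e1] at d1
  rw [e2] at d2
  rw [e3] at d3
  rw [e4] at d4
  push_cast at d2 d3 d4
  by_cases hi : Even (i : ℕ)
  · have hj : ¬ Even (j : ℕ) := by rw [h]; grind
    simp only [outerDist, Edge.src, Edge.tgt, hi, hj, if_true, if_false, d1, d2, d3, d4]
    omega
  · have hj : Even (j : ℕ) := by rw [h]; grind
    simp only [outerDist, Edge.src, Edge.tgt, hi, hj, if_true, if_false, d1, d2, d3, d4]
    omega

/-- The only coefficient that has to be evaluated, since no other disjoint pair will have crossings.
-/
theorem epsilon_antipodal {N : ℕ} {i j : Fin (2 * (2 * N + 1))} (h : (j : ℕ) = i + (2 * N + 1)) :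
    epsilon (Sum.inl i : Edge N) (Sum.inl j) = -1 := by
  have : ¬ Odd (2 * N) := by grind
  simp [epsilon, outerDist_antipodal h, this]

end MobiusLadder

namespace MobiusLadder

/-! ### Points of the realization of a Möbius ladder -/

/-- The point `(1 - t) u + t v` in the vector space spanned by the vertices. -/
noncomputable def mix {V : Type*} [DecidableEq V] (u v : V) (t : ℝ) : V → ℝ :=
  (1 - t) • Pi.single u 1 + t • Pi.single v 1

section Mix

variable {V : Type*} [DecidableEq V]

theorem mix_apply (u v w : V) (t : ℝ) :
    mix u v t w = (if w = u then 1 - t else 0) + if w = v then t else 0 := by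
  simp [mix, Pi.single_apply]

theorem mix_one_sub (u v : V) (t : ℝ) : mix u v (1 - t) = mix v u t := by
  simp [mix, add_comm]

theorem mix_zero (u v : V) : mix u v 0 = Pi.single u 1 := by simp [mix]

theorem mix_one (u v : V) : mix u v 1 = Pi.single v 1 := by simp [mix]

/-- Basis coordinates determine the point. The first four cases are a shared vertex, the last two
the same edge read in the same or the opposite direction. -/
theorem mix_eq_mix {u v u' v' : V} {t s : ℝ} (huv : u ≠ v) (huv' : u' ≠ v')
    (h : mix u v t = mix u' v' s) :
    (t = 0 ∧ s = 0 ∧ u = u') ∨ (t = 0 ∧ s = 1 ∧ u = v') ∨ (t = 1 ∧ s = 0 ∧ v = u') ∨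
      (t = 1 ∧ s = 1 ∧ v = v') ∨ (s = t ∧ u = u' ∧ v = v') ∨ (s = 1 - t ∧ u = v' ∧ v = u') := by
  have h1 := congrFun h u
  have h2 := congrFun h v
  have h3 := congrFun h u'
  have h4 := congrFun h v'
  simp only [mix_apply] at h1 h2 h3 h4
  by_cases a1 : u = u' <;> by_cases a2 : u = v' <;> by_cases a3 : v = u' <;>
    by_cases a4 : v = v' <;> grind

end Mix

/-- The point at parameter `u` of the outer circle, where the vertices have integral parameters. -/
noncomputable def outerPoint (n : ℕ) (u : ℝ) : ZMod (2 * n) → ℝ :=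
  mix ((⌊u⌋ : ℤ) : ZMod (2 * n)) ((⌊u⌋ : ℤ) + 1) (Int.fract u)

/-- The point at parameter `t` of the rung joining the vertices `k` and `k + n`. -/
noncomputable def rungPoint (n : ℕ) (k : ℤ) (t : ℝ) : ZMod (2 * n) → ℝ :=
  mix (k : ZMod (2 * n)) (k + n) t

section Points

variable {n : ℕ}

theorem outerPoint_intCast_add (k : ℤ) {t : ℝ} (ht : t ∈ Set.Icc (0 : ℝ) 1) :
    outerPoint n (k + t) = mix (k : ZMod (2 * n)) (k + 1) t := by
  -- At t = 1 the floor jumps to k + 1, but the end of one edge is the start of the next.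
  rcases ht.2.eq_or_lt with rfl | h1
  · have hf : ⌊(k : ℝ) + 1⌋ = k + 1 := by simp
    have hr : Int.fract ((k : ℝ) + 1) = 0 := by simp
    rw [outerPoint, hf, hr, mix_zero, mix_one]
    push_cast
    rfl
  · have hf : ⌊(k : ℝ) + t⌋ = k := by
      rw [Int.floor_eq_iff]; constructor <;> linarith [ht.1]
    have hr : Int.fract ((k : ℝ) + t) = t := by
      rw [Int.fract, hf]; ring
    rw [outerPoint, hf, hr]

theorem outerPoint_intCast (k : ℤ) : outerPoint n k = Pi.single (k : ZMod (2 * n)) 1 := by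
  simpa [mix_zero] using outerPoint_intCast_add (n := n) k (t := 0) (by simp)

theorem intCast_add_two_mul (k l : ℤ) : ((k + 2 * n * l : ℤ) : ZMod (2 * n)) = k := by
  have := natCast_add_self n
  push_cast
  linear_combination (l : ZMod (2 * n)) * this

theorem outerPoint_add_period (u : ℝ) (l : ℤ) : outerPoint n (u + 2 * n * l) = outerPoint n u := by
  have h : u + 2 * n * l = u + ((2 * n * l : ℤ) : ℝ) := by push_cast; ring
  rw [outerPoint, h, Int.floor_add_intCast, Int.fract_add_intCast, intCast_add_two_mul]
  rfl

theorem rungPoint_add_period (k l : ℤ) (t : ℝ) :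
    rungPoint n (k + 2 * n * l) t = rungPoint n k t := by
  rw [rungPoint, intCast_add_two_mul, rungPoint]

theorem rungPoint_add_half (k : ℤ) (t : ℝ) : rungPoint n (k + n) t = rungPoint n k (1 - t) := by
  rw [rungPoint, rungPoint, mix_one_sub]
  have := natCast_add_self n
  push_cast
  congr 1
  linear_combination this

theorem rungPoint_zero (k : ℤ) : rungPoint n k 0 = outerPoint n k := by
  rw [rungPoint, mix_zero, outerPoint_intCast]

theorem intCast_eq_iff {k l : ℤ} : (k : ZMod (2 * n)) = l ↔ ∃ d : ℤ, l = k + 2 * n * d := by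
  rw [ZMod.intCast_eq_intCast_iff_dvd_sub]
  push_cast
  constructor
  · rintro ⟨d, hd⟩; exact ⟨d, by linarith⟩
  · rintro ⟨d, hd⟩; exact ⟨d, by linarith⟩

theorem add_one_ne (hn : 2 ≤ n) (x : ZMod (2 * n)) : x ≠ x + 1 := fun h =>
  intCast_ne_zero_of_abs_lt (n := n) (c := 1) (by omega) (by rw [abs_lt]; omega)
    (by push_cast; linear_combination -h)

theorem add_half_ne (hn : 2 ≤ n) (x : ZMod (2 * n)) : x ≠ x + n := fun h =>
  intCast_ne_zero_of_abs_lt (n := n) (c := n) (by omega) (by rw [abs_lt]; omega)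
    (by push_cast; linear_combination -h)

theorem outerPoint_eq_outerPoint (hn : 2 ≤ n) {u u' : ℝ} (h : outerPoint n u = outerPoint n u') :
    ∃ l : ℤ, u' = u + 2 * n * l := by
  have main : ((⌊u⌋ : ℤ) : ZMod (2 * n)) = (⌊u'⌋ : ℤ) → Int.fract u' = Int.fract u →
      ∃ l : ℤ, u' = u + 2 * n * l := by
    intro h1 h2
    obtain ⟨d, hd⟩ := intCast_eq_iff.1 h1
    refine ⟨d, ?_⟩
    have := congrArg (Int.cast : ℤ → ℝ) hd
    push_cast at this
    linarith [Int.floor_add_fract u, Int.floor_add_fract u']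
  have l1 := Int.fract_lt_one u
  have l2 := Int.fract_lt_one u'
  rcases mix_eq_mix (add_one_ne hn _) (add_one_ne hn _) h with
    ⟨h1, h2, h3⟩ | ⟨h1, h2, h3⟩ | ⟨h1, h2, h3⟩ | ⟨h1, h2, h3⟩ | ⟨h1, h2, h3⟩ | ⟨h1, h2, h3⟩
  · exact main h3 (by rw [h1, h2])
  · linarith
  · linarith
  · linarith
  · exact main h2 h1
  · refine absurd ?_ (intCast_ne_zero_of_abs_lt (n := n) (c := 2) (by omega)
      (by rw [abs_lt]; omega))
    push_cast; linear_combination h3 - h2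

theorem rungPoint_eq_rungPoint (hn : 2 ≤ n) {k k' : ℤ} {t t' : ℝ}
    (h : rungPoint n k t = rungPoint n k' t') :
    ∃ l : ℤ, (k' = k + 2 * n * l ∧ t' = t) ∨ (k' = k + n + 2 * n * l ∧ t' = 1 - t) := by
  have h3 := natCast_add_self n
  have same : (k : ZMod (2 * n)) = k' → t' = t →
      ∃ l : ℤ, (k' = k + 2 * n * l ∧ t' = t) ∨ (k' = k + n + 2 * n * l ∧ t' = 1 - t) := by
    intro h1 h2
    obtain ⟨l, hl⟩ := intCast_eq_iff.1 h1
    exact ⟨l, Or.inl ⟨hl, h2⟩⟩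
  have opp : (k : ZMod (2 * n)) + n = k' → t' = 1 - t →
      ∃ l : ℤ, (k' = k + 2 * n * l ∧ t' = t) ∨ (k' = k + n + 2 * n * l ∧ t' = 1 - t) := by
    intro h1 h2
    obtain ⟨l, hl⟩ := intCast_eq_iff (n := n) (k := k + n) (l := k') |>.1 (by push_cast; exact h1)
    exact ⟨l, Or.inr ⟨hl, h2⟩⟩
  rcases mix_eq_mix (add_half_ne hn _) (add_half_ne hn _) h with
    ⟨h1, h2, h4⟩ | ⟨h1, h2, h4⟩ | ⟨h1, h2, h4⟩ | ⟨h1, h2, h4⟩ | ⟨h1, h2, h4⟩ | ⟨h1, h2, h4⟩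
  · exact same h4 (by rw [h1, h2])
  · exact opp (by linear_combination h4 + h3) (by rw [h1, h2]; ring)
  · exact opp h4 (by rw [h1, h2]; ring)
  · exact same (by linear_combination h4) (by rw [h1, h2])
  · exact same h2 h1
  · exact opp h4 h1

theorem rungPoint_eq_outerPoint (hn : 2 ≤ n) {k : ℤ} {t u : ℝ}
    (h : rungPoint n k t = outerPoint n u) :
    ∃ l : ℤ, (u = k + 2 * n * l ∧ t = 0) ∨ (u = k + n + 2 * n * l ∧ t = 1) := by
  have l2 := Int.fract_lt_one u
  have key : ∀ {k' : ℤ}, (k' : ZMod (2 * n)) = (⌊u⌋ : ℤ) → Int.fract u = 0 →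
      ∃ l : ℤ, u = k' + 2 * n * l := by
    intro k' h1 h2
    obtain ⟨l, hl⟩ := intCast_eq_iff.1 h1
    have := congrArg (Int.cast : ℤ → ℝ) hl
    push_cast at this
    exact ⟨l, by linarith [Int.floor_add_fract u]⟩
  rcases mix_eq_mix (add_half_ne hn _) (add_one_ne hn _) h with
    ⟨h1, h2, h4⟩ | ⟨h1, h2, h4⟩ | ⟨h1, h2, h4⟩ | ⟨h1, h2, h4⟩ | ⟨h1, h2, h4⟩ | ⟨h1, h2, h4⟩
  · obtain ⟨l, hl⟩ := key h4 h2
    exact ⟨l, Or.inl ⟨hl, h1⟩⟩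
  · linarith
  · obtain ⟨l, hl⟩ := key (k' := k + n) (by push_cast; exact h4) h2
    exact ⟨l, Or.inr ⟨by rw [hl]; push_cast; ring, h1⟩⟩
  · linarith
  · refine absurd ?_ (intCast_ne_zero_of_abs_lt (n := n) (c := n - 1) (by omega)
      (by rw [abs_lt]; omega))
    push_cast; linear_combination h4 - h2
  · refine absurd ?_ (intCast_ne_zero_of_abs_lt (n := n) (c := n + 1) (by omega)
      (by rw [abs_lt]; omega))
    push_cast; linear_combination h4 - h2

theorem exists_outerPoint_or_rungPoint (hn : 2 ≤ n) (p : (graph n).realization) :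
    (∃ u, p.1 = outerPoint n u) ∨
      ∃ k : ℤ, ∃ t ∈ Set.Icc (0 : ℝ) 1, p.1 = rungPoint n k t := by
  obtain ⟨p, u, v, h, a, b, ha, hb, hab, rfl⟩ := p
  obtain rfl : a = 1 - b := by linarith
  obtain ⟨k, rfl⟩ := ZMod.intCast_surjective u
  change (∃ u, mix _ _ _ = _) ∨ ∃ k : ℤ, ∃ t ∈ Set.Icc (0 : ℝ) 1, mix _ _ _ = _
  rcases h with rfl | h
  · left
    refine ⟨k, ?_⟩
    rw [outerPoint_intCast, mix, ← add_smul]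
    simp
  · rcases (graph_adj_iff hn).1 h with rfl | rfl | rfl
    · exact Or.inl ⟨k + b, (outerPoint_intCast_add k ⟨hb, by linarith⟩).symm⟩
    · left
      refine ⟨((k - 1 : ℤ) : ℝ) + (1 - b), ?_⟩
      rw [outerPoint_intCast_add _ ⟨ha, by linarith⟩, mix_one_sub]
      push_cast
      simp
    · exact Or.inr ⟨k, b, ⟨hb, by linarith⟩, rfl⟩

/-! ### Oriented edges -/

/-- The position on the outer circle of the point at parameter `t` of the oriented outer edge
`xᵢ`. -/
noncomputable def outerParam (i : ℕ) (t : ℝ) : ℝ := if Even i then i + t else i + 1 - t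

theorem outerParam_mem_Ioo (i : ℕ) {t : ℝ} (ht : t ∈ Set.Ioo (0 : ℝ) 1) :
    outerParam i t ∈ Set.Ioo (i : ℝ) (i + 1) := by
  unfold outerParam
  split_ifs <;> constructor <;> linarith [ht.1, ht.2]

/-- The position along the rung from `j` to `j + n` of the point at parameter `t` of the oriented
rung `yⱼ`. -/
noncomputable def rungParam (j : ℕ) (t : ℝ) : ℝ := if Even j then 1 - t else t

theorem rungParam_mem_Icc (j : ℕ) {t : ℝ} (ht : t ∈ Set.Icc (0 : ℝ) 1) :
    rungParam j t ∈ Set.Icc (0 : ℝ) 1 := by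
  unfold rungParam
  split_ifs <;> constructor <;> linarith [ht.1, ht.2]

theorem rungParam_mem_Ioo (j : ℕ) {t : ℝ} (ht : t ∈ Set.Ioo (0 : ℝ) 1) :
    rungParam j t ∈ Set.Ioo (0 : ℝ) 1 := by
  unfold rungParam
  split_ifs <;> constructor <;> linarith [ht.1, ht.2]

theorem exists_outerParam_eq (i : ℕ) {s : ℝ} (hs : s ∈ Set.Icc (0 : ℝ) 1) :
    ∃ t ∈ Set.Icc (0 : ℝ) 1, outerParam i t = i + s := by
  unfold outerParam
  split_ifs
  · exact ⟨s, hs, rfl⟩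
  · exact ⟨1 - s, ⟨by linarith [hs.2], by linarith [hs.1]⟩, by ring⟩

theorem exists_rungParam_eq (j : ℕ) {s : ℝ} (hs : s ∈ Set.Icc (0 : ℝ) 1) :
    ∃ t ∈ Set.Icc (0 : ℝ) 1, rungParam j t = s := by
  unfold rungParam
  split_ifs
  · exact ⟨1 - s, ⟨by linarith [hs.2], by linarith [hs.1]⟩, by ring⟩
  · exact ⟨s, hs, rfl⟩

theorem exists_eq_natCast_add (hn : 0 < n) (k : ℤ) :
    ∃ i < 2 * n, ∃ l : ℤ, k = (i : ℕ) + 2 * n * l := by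
  have h0 : 0 ≤ k % (2 * n) := Int.emod_nonneg _ (by omega)
  have h1 : k % (2 * n) < 2 * n := Int.emod_lt_of_pos _ (by omega)
  refine ⟨(k % (2 * n)).toNat, by omega, k / (2 * n), ?_⟩
  rw [Int.toNat_of_nonneg h0]
  exact (Int.emod_add_mul_ediv k (2 * n)).symm

end Points

section Edges

variable {N : ℕ}

theorem Edge.point_val (a : Edge N) {t : ℝ} (ht : t ∈ Set.Icc (0 : ℝ) 1) :
    (a.point t).1 = mix a.src a.tgt t := by
  rw [Edge.point, Set.projIcc_of_mem _ ht]
  rfl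

theorem Edge.point_inl (i : Fin (2 * (2 * N + 1))) {t : ℝ} (ht : t ∈ Set.Icc (0 : ℝ) 1) :
    (Edge.point (Sum.inl i : Edge N) t).1 = outerPoint (2 * N + 1) (outerParam i t) := by
  rw [Edge.point_val _ ht, Edge.src, Edge.tgt, outerParam]
  by_cases h : Even (i : ℕ)
  · simp only [h, if_true]
    simpa using (outerPoint_intCast_add (n := 2 * N + 1) (i : ℕ) ht).symm
  · simp only [h, if_false]
    rw [← mix_one_sub, add_sub_assoc]
    simpa using (outerPoint_intCast_add (n := 2 * N + 1) (i : ℕ)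
      (t := 1 - t) ⟨by linarith [ht.2], by linarith [ht.1]⟩).symm

theorem Edge.point_inr (j : Fin (2 * N + 1)) {t : ℝ} (ht : t ∈ Set.Icc (0 : ℝ) 1) :
    (Edge.point (Sum.inr j : Edge N) t).1 = rungPoint (2 * N + 1) (j : ℕ) (rungParam j t) := by
  rw [Edge.point_val _ ht, Edge.src, Edge.tgt, rungParam, rungPoint]
  by_cases h : Even (j : ℕ)
  · simp only [h, if_true, mix_one_sub]
    simp
  · simp only [h, if_false]
    simp

theorem Edge.exists_point_eq (hN : 1 ≤ N) (p : Space N) :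
    ∃ a : Edge N, ∃ t ∈ Set.Icc (0 : ℝ) 1, a.point t = p := by
  rcases exists_outerPoint_or_rungPoint (by omega) p with ⟨u, hu⟩ | ⟨k, s, hs, hu⟩
  · obtain ⟨i, hi, l, hl⟩ := exists_eq_natCast_add (n := 2 * N + 1) (by omega) ⌊u⌋
    obtain ⟨t, ht, hts⟩ := exists_outerParam_eq i ⟨Int.fract_nonneg u, (Int.fract_lt_one u).le⟩
    refine ⟨Sum.inl ⟨i, hi⟩, t, ht, Subtype.ext ?_⟩
    rw [Edge.point_inl _ ht, hu, hts, ← outerPoint_add_period _ l]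
    congr 1
    have := congrArg (Int.cast : ℤ → ℝ) hl
    push_cast at this ⊢
    linarith [Int.floor_add_fract u]
  · obtain ⟨i, hi, l, rfl⟩ := exists_eq_natCast_add (n := 2 * N + 1) (by omega) k
    rw [rungPoint_add_period] at hu
    rcases lt_or_ge i (2 * N + 1) with h | h
    · obtain ⟨t, ht, hts⟩ := exists_rungParam_eq i hs
      refine ⟨Sum.inr ⟨i, h⟩, t, ht, Subtype.ext ?_⟩
      rw [Edge.point_inr _ ht, hu, hts]
    -- Only rungs starting at 0, …, 2N carry labels; a rung read from vertex j + 2N + 1 is rung j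
    -- traversed backwards.
    · obtain ⟨j, rfl⟩ := Nat.exists_eq_add_of_le' h
      obtain ⟨t, ht, hts⟩ := exists_rungParam_eq j (s := 1 - s)
        ⟨by linarith [hs.2], by linarith [hs.1]⟩
      refine ⟨Sum.inr ⟨j, by omega⟩, t, ht, Subtype.ext ?_⟩
      rw [Edge.point_inr _ ht, hu, hts, ← rungPoint_add_half]
      push_cast
      rfl

theorem Edge.continuous_point (a : Edge N) : Continuous a.point := by
  refine Continuous.subtype_mk ?_ _
  have h : Continuous fun t : ℝ => (Set.projIcc (0 : ℝ) 1 zero_le_one t : ℝ) :=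
    continuous_subtype_val.comp continuous_projIcc
  fun_prop

end Edges

/-! ### Automorphisms in terms of circle and rung parameters -/

section Automorphism

variable {n : ℕ}

theorem realizationMap_mix (α : graph n ≃g graph n) {p : (graph n).realization}
    {u v : ZMod (2 * n)} {t : ℝ} (hp : p.1 = mix u v t) :
    ((graph n).realizationMap α p).1 = mix (α u) (α v) t := by
  funext w
  change p.1 (α.symm w) = _
  have e : ∀ x, (α.symm w = x) = (w = α x) := fun x => by
    rw [eq_iff_iff]
    constructor
    · rintro rfl; simp
    · rintro rfl; simp
  simp only [hp, mix_apply, e]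

theorem realizationMap_outerPoint_of_rotation {α : graph n ≃g graph n} {c : ℤ}
    (hα : ∀ k : ℤ, α k = ((k + c : ℤ) : ZMod (2 * n))) {p : (graph n).realization} {u : ℝ}
    (hp : p.1 = outerPoint n u) :
    ((graph n).realizationMap α p).1 = outerPoint n (u + c) := by
  rw [realizationMap_mix α hp, outerPoint, Int.floor_add_intCast, Int.fract_add_intCast, hα]
  have := hα (⌊u⌋ + 1)
  push_cast at this ⊢
  rw [this]
  congr 1
  ring

theorem realizationMap_rungPoint_of_rotation {α : graph n ≃g graph n} {c : ℤ}
    (hα : ∀ k : ℤ, α k = ((k + c : ℤ) : ZMod (2 * n))) {p : (graph n).realization} {k : ℤ} {t : ℝ}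
    (hp : p.1 = rungPoint n k t) :
    ((graph n).realizationMap α p).1 = rungPoint n (k + c) t := by
  rw [realizationMap_mix α hp, rungPoint, hα]
  have := hα (k + n)
  push_cast at this ⊢
  rw [this]
  congr 1
  ring

theorem realizationMap_outerPoint_of_reflection {α : graph n ≃g graph n} {c : ℤ}
    (hα : ∀ k : ℤ, α k = ((c - k : ℤ) : ZMod (2 * n))) {p : (graph n).realization} {u : ℝ}
    (hp : p.1 = outerPoint n u) :
    ((graph n).realizationMap α p).1 = outerPoint n (c - u) := by
  have e : c - u = ((c - ⌊u⌋ - 1 : ℤ) : ℝ) + (1 - Int.fract u) := by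
    push_cast; linarith [Int.floor_add_fract u]
  rw [realizationMap_mix α hp, e, outerPoint_intCast_add _
    ⟨by linarith [Int.fract_lt_one u], by linarith [Int.fract_nonneg u]⟩, mix_one_sub, hα]
  have := hα (⌊u⌋ + 1)
  push_cast at this ⊢
  rw [this]
  congr 1 <;> ring

theorem realizationMap_rungPoint_of_reflection {α : graph n ≃g graph n} {c : ℤ}
    (hα : ∀ k : ℤ, α k = ((c - k : ℤ) : ZMod (2 * n))) {p : (graph n).realization} {k : ℤ} {t : ℝ}
    (hp : p.1 = rungPoint n k t) :
    ((graph n).realizationMap α p).1 = rungPoint n (c - k) t := by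
  rw [realizationMap_mix α hp, rungPoint, hα]
  have := hα (k + n)
  push_cast at this ⊢
  rw [this]
  congr 1
  linear_combination -natCast_add_self n

end Automorphism

end MobiusLadder

/-! ### A twisted ribbon in the three-sphere -/

/-- The point of `S³ ⊆ ℂ²` with moduli `cos ψ`, `sin ψ` and arguments `θ`, `φ`. -/
noncomputable def Sphere3.polar (θ φ ψ : ℝ) : Sphere3 :=
  ⟨!₂[Real.cos ψ * Real.cos θ, Real.cos ψ * Real.sin θ, Real.sin ψ * Real.sin φ,
    Real.sin ψ * Real.cos φ], by
    rw [mem_sphere_zero_iff_norm, EuclideanSpace.norm_eq, Real.sqrt_eq_one]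
    simp only [Fin.sum_univ_four, Real.norm_eq_abs, sq_abs]
    simp
    nlinarith [Real.sin_sq_add_cos_sq θ, Real.sin_sq_add_cos_sq φ, Real.sin_sq_add_cos_sq ψ]⟩

namespace MobiusLadder

/-- The direction of the ribbon's cross section at parameter `u`. -/
noncomputable def longitude (n : ℕ) (u : ℝ) : ℝ := 2 * Real.pi * u / n

/-- The angle by which the ribbon is twisted at parameter `u`. -/
noncomputable def twist (n : ℕ) (a : ℤ) (u : ℝ) : ℝ :=
  Real.pi * (2 * a * u + 1) / (2 * n) + Real.pi / 2

/-- The point at position `ψ` of the cross section at parameter `u` of a ribbon with `a` half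
twists around an unknotted circle. -/
noncomputable def ribbonPoint (n : ℕ) (a : ℤ) (u ψ : ℝ) : Sphere3 :=
  Sphere3.polar (longitude n u) (twist n a u) ψ

/-- The distance from the origin of the shadow of a point of the ribbon. -/
noncomputable def ribbonRadius (n : ℕ) (a : ℤ) (u ψ : ℝ) : ℝ :=
  Real.cos ψ / (1 - Real.sin ψ * Real.cos (twist n a u))

section Ribbon

variable {n : ℕ} {a : ℤ}

theorem longitude_add_mul (hn : 0 < n) (u : ℝ) (l : ℤ) :
    longitude n (u + n * l) = longitude n u + l * (2 * Real.pi) := by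
  have : (n : ℝ) ≠ 0 := by positivity
  unfold longitude; field_simp

theorem twist_add_mul (hn : 0 < n) (u : ℝ) (l : ℤ) :
    twist n a (u + n * l) = twist n a u + (a * l : ℤ) * Real.pi := by
  have : (n : ℝ) ≠ 0 := by positivity
  unfold twist; push_cast; field_simp; ring

/-- One revolution adds 2π to the first angle and aπ to the second. For odd a this negates the
second complex coordinate, just as ψ ↦ -ψ does: the ribbon is a Möbius band. -/
theorem ribbonPoint_add_half (hn : 0 < n) (ha : Odd a) (u ψ : ℝ) :
    ribbonPoint n a (u + n) ψ = ribbonPoint n a u (-ψ) := by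
  have e1 := longitude_add_mul hn u 1
  have e2 := twist_add_mul (a := a) hn u 1
  simp only [Int.cast_one, mul_one, one_mul] at e1 e2
  obtain ⟨b, rfl⟩ := ha
  have e3 : twist n (2 * b + 1) u + ((2 * b + 1 : ℤ) : ℝ) * Real.pi
      = twist n (2 * b + 1) u + Real.pi + b * (2 * Real.pi) := by push_cast; ring
  apply Subtype.ext
  simp only [ribbonPoint, Sphere3.polar, e1, e2, e3, Real.cos_add_int_mul_two_pi,
    Real.sin_add_int_mul_two_pi, Real.cos_add_two_pi, Real.sin_add_two_pi, Real.cos_add_pi,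
    Real.sin_add_pi, Real.cos_neg, Real.sin_neg]
  simp

theorem ribbonPoint_add_period (hn : 0 < n) (u ψ : ℝ) (l : ℤ) :
    ribbonPoint n a (u + 2 * n * l) ψ = ribbonPoint n a u ψ := by
  have e1 := longitude_add_mul hn u (2 * l)
  have e2 := twist_add_mul (a := a) hn u (2 * l)
  have e3 : twist n a u + ((a * (2 * l) : ℤ) : ℝ) * Real.pi
      = twist n a u + ((a * l : ℤ) : ℝ) * (2 * Real.pi) := by push_cast; ring
  have e4 : u + 2 * n * l = u + n * ((2 * l : ℤ) : ℝ) := by push_cast; ring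
  apply Subtype.ext
  simp only [ribbonPoint, Sphere3.polar, e4, e1, e2, e3, Real.cos_add_int_mul_two_pi,
    Real.sin_add_int_mul_two_pi]

theorem shadow_ribbonPoint (u ψ : ℝ) :
    (ribbonPoint n a u ψ).shadow = (ribbonRadius n a u ψ * Real.cos (longitude n u),
      ribbonRadius n a u ψ * Real.sin (longitude n u)) := by
  simp only [ribbonPoint, Sphere3.shadow, Sphere3.polar, ribbonRadius]
  simp
  constructor <;> ring

theorem height_ribbonPoint (u ψ : ℝ) :
    (ribbonPoint n a u ψ).height =
      Real.sin ψ * Real.sin (twist n a u) / (1 - Real.sin ψ * Real.cos (twist n a u)) := by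
  simp [ribbonPoint, Sphere3.height, Sphere3.polar]

/-- The product is the last coordinate of a ribbon point, so the ribbon avoids the centre of
projection and the denominators of shadow and height are positive. -/
theorem sin_mul_cos_lt_one {ψ : ℝ} (h : 0 < Real.cos ψ) (x : ℝ) :
    0 < 1 - Real.sin ψ * Real.cos x := by
  nlinarith [Real.sin_sq_add_cos_sq ψ, Real.sin_sq_add_cos_sq x, sq_nonneg (Real.sin ψ - Real.cos x),
    sq_nonneg (Real.sin x), mul_pos h h]

theorem ribbonRadius_pos {ψ : ℝ} (h : 0 < Real.cos ψ) (u : ℝ) : 0 < ribbonRadius n a u ψ :=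
  div_pos h (sin_mul_cos_lt_one h _)

/-- The shadow has polar angle `longitude n u` and positive radius, so it determines the longitude
modulo 2π, that is, u modulo n. -/
theorem shadow_ribbonPoint_eq (hn : 0 < n) {u u' ψ ψ' : ℝ} (h : 0 < Real.cos ψ)
    (h' : 0 < Real.cos ψ') (hs : (ribbonPoint n a u ψ).shadow = (ribbonPoint n a u' ψ').shadow) :
    ∃ l : ℤ, u' = u + n * l := by
  have r1 := ribbonRadius_pos (n := n) (a := a) h u
  have r2 := ribbonRadius_pos (n := n) (a := a) h' u'
  rw [shadow_ribbonPoint, shadow_ribbonPoint, Prod.mk.injEq] at hs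
  obtain ⟨hc, hsn⟩ := hs
  have hr : ribbonRadius n a u ψ = ribbonRadius n a u' ψ' := by
    rw [← sq_eq_sq₀ r1.le r2.le]
    have e1 := congrArg (· ^ 2) hc
    have e2 := congrArg (· ^ 2) hsn
    simp only [mul_pow] at e1 e2
    linear_combination e1 + e2 - ribbonRadius n a u ψ ^ 2 * Real.sin_sq_add_cos_sq (longitude n u) +
      ribbonRadius n a u' ψ' ^ 2 * Real.sin_sq_add_cos_sq (longitude n u')
  rw [hr] at hc hsn
  have := Real.Angle.cos_sin_inj (mul_left_cancel₀ r2.ne' hc) (mul_left_cancel₀ r2.ne' hsn)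
  obtain ⟨l, hl⟩ := Real.Angle.angle_eq_iff_two_pi_dvd_sub.1 this
  refine ⟨-l, ?_⟩
  have hn' : (n : ℝ) ≠ 0 := by positivity
  unfold longitude at hl
  have hpi := Real.pi_ne_zero
  push_cast
  field_simp at hl
  linarith

/-- The ribbon's half width `ψ₀` is so small that no rung has a point where its shadow stops. -/
structure IsAdmissible (n : ℕ) (a : ℤ) (ψ₀ : ℝ) : Prop where
  two_le : 2 ≤ n
  odd : Odd a
  pos : 0 < ψ₀
  lt : ψ₀ < Real.pi / 2
  sin_lt : ∀ k : ℤ, Real.sin ψ₀ < |Real.cos (twist n a k)|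

theorem cos_twist_eq_zero_iff (hn : 0 < n) {u : ℝ} :
    Real.cos (twist n a u) = 0 ↔ ∃ l : ℤ, 2 * a * u + 1 = 2 * n * l := by
  have hn' : (n : ℝ) ≠ 0 := by positivity
  have hpi := Real.pi_ne_zero
  rw [twist, Real.cos_add_pi_div_two, neg_eq_zero, Real.sin_eq_zero_iff]
  refine exists_congr fun l => ?_
  field_simp
  constructor <;> intro h <;> linarith

/-- A zero would equate an odd and an even integer. This is the purpose of the offset π / (2n) in
`twist`. -/
theorem cos_twist_intCast_ne_zero (hn : 0 < n) (k : ℤ) : Real.cos (twist n a k) ≠ 0 := by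
  rw [Ne, cos_twist_eq_zero_iff hn]
  rintro ⟨l, hl⟩
  have : 2 * a * k + 1 = 2 * n * l := by exact_mod_cast hl
  have h2 : 2 * (n * l - a * k) = 1 := by linarith
  omega

theorem cos_twist_add_period (hn : 0 < n) (u : ℝ) (l : ℤ) :
    Real.cos (twist n a (u + 2 * n * l)) = Real.cos (twist n a u) := by
  have e2 := twist_add_mul (a := a) hn u (2 * l)
  have e3 : twist n a u + ((a * (2 * l) : ℤ) : ℝ) * Real.pi
      = twist n a u + ((a * l : ℤ) : ℝ) * (2 * Real.pi) := by push_cast; ring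
  have e4 : u + 2 * n * l = u + n * ((2 * l : ℤ) : ℝ) := by push_cast; ring
  rw [e4, e2, e3, Real.cos_add_int_mul_two_pi]

theorem exists_isAdmissible (hn : 2 ≤ n) (ha : Odd a) : ∃ ψ₀, IsAdmissible n a ψ₀ := by
  obtain ⟨i, -, hi⟩ := Finset.exists_min_image (Finset.range (2 * n))
    (fun i : ℕ => |Real.cos (twist n a (i : ℤ))|) ⟨0, by simp; omega⟩
  set r := |Real.cos (twist n a (i : ℤ))| with hr
  have r0 : 0 < r := abs_pos.2 (cos_twist_intCast_ne_zero (by omega) _)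
  have r1 : r ≤ 1 := Real.abs_cos_le_one _
  have hpi := Real.pi_gt_three
  -- By periodicity the minimum r over 2n sections bounds all of them. Then sin (r / 2) < r / 2 < r,
  -- and r ≤ 1 keeps r / 2 below π / 2.
  refine ⟨r / 2, hn, ha, by linarith, by linarith, fun k => ?_⟩
  have : r ≤ |Real.cos (twist n a k)| := by
    obtain ⟨j, hj, l, rfl⟩ := exists_eq_natCast_add (n := n) (by omega) k
    push_cast
    rw [cos_twist_add_period (by omega)]
    simpa using hi j (by simpa using hj)
  linarith [Real.sin_lt (x := r / 2) (by linarith)]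

namespace IsAdmissible

variable {ψ₀ : ℝ}

theorem n_pos (H : IsAdmissible n a ψ₀) : 0 < n := by have := H.two_le; omega

theorem sin_pos (H : IsAdmissible n a ψ₀) : 0 < Real.sin ψ₀ :=
  Real.sin_pos_of_pos_of_lt_pi H.pos (by linarith [H.lt, Real.pi_pos])

theorem cos_pos (H : IsAdmissible n a ψ₀) {ψ : ℝ} (h : ψ ∈ Set.Icc (-ψ₀) ψ₀) : 0 < Real.cos ψ :=
  Real.cos_pos_of_mem_Ioo ⟨by linarith [h.1, H.lt], by linarith [h.2, H.lt]⟩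

theorem self_mem (H : IsAdmissible n a ψ₀) : ψ₀ ∈ Set.Icc (-ψ₀) ψ₀ := ⟨by linarith [H.pos], le_rfl⟩

theorem abs_sin_le (H : IsAdmissible n a ψ₀) {ψ : ℝ} (h : ψ ∈ Set.Icc (-ψ₀) ψ₀) :
    |Real.sin ψ| ≤ Real.sin ψ₀ := by
  rw [abs_le, ← Real.sin_neg]
  constructor
  · exact Real.sin_le_sin_of_le_of_le_pi_div_two (by linarith [H.lt]) (by linarith [h.2, H.lt]) h.1
  · exact Real.sin_le_sin_of_le_of_le_pi_div_two (by linarith [h.1, H.lt]) H.lt.le h.2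

/-- Square the equality of radii and split off the factor sin ψ - sin ψ'. The cofactor is a sum of
two terms with the strict sign of c = cos (twist), because both sines are smaller than |c| in
absolute value. -/
theorem section_injective (H : IsAdmissible n a ψ₀) {k : ℤ} {ψ ψ' : ℝ} (h : ψ ∈ Set.Icc (-ψ₀) ψ₀)
    (h' : ψ' ∈ Set.Icc (-ψ₀) ψ₀)
    (hs : (ribbonPoint n a k ψ).shadow = (ribbonPoint n a k ψ').shadow) : ψ = ψ' := by
  have c1 := H.cos_pos h
  have c2 := H.cos_pos h'
  have r1 := ribbonRadius_pos (n := n) (a := a) c1 k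
  have r2 := ribbonRadius_pos (n := n) (a := a) c2 k
  have hr : ribbonRadius n a k ψ = ribbonRadius n a k ψ' := by
    rw [shadow_ribbonPoint, shadow_ribbonPoint, Prod.mk.injEq] at hs
    linear_combination Real.cos (longitude n k) * hs.1 + Real.sin (longitude n k) * hs.2 -
      (ribbonRadius n a k ψ - ribbonRadius n a k ψ') * Real.sin_sq_add_cos_sq (longitude n k)
  have x1 := (H.abs_sin_le h).trans_lt (H.sin_lt k)
  have x2 := (H.abs_sin_le h').trans_lt (H.sin_lt k)
  have d1 := sin_mul_cos_lt_one c1 (twist n a k)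
  have d2 := sin_mul_cos_lt_one c2 (twist n a k)
  have cc : Real.cos (twist n a k) ^ 2 ≤ 1 := Real.cos_sq_le_one _
  rw [ribbonRadius, ribbonRadius, div_eq_div_iff d1.ne' d2.ne'] at hr
  refine Real.injOn_sin ⟨by linarith [h.1, H.lt], by linarith [h.2, H.lt]⟩
    ⟨by linarith [h'.1, H.lt], by linarith [h'.2, H.lt]⟩ ?_
  have s1 := Real.sin_sq_add_cos_sq ψ
  have s2 := Real.sin_sq_add_cos_sq ψ'
  have hsq := congrArg (· ^ 2) hr
  simp only [mul_pow] at hsq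
  generalize Real.cos (twist n a k) = c at *
  generalize Real.sin ψ = X at *
  generalize Real.sin ψ' = Y at *
  have key : (X - Y) * ((c - X) * (1 - Y * c) + (c - Y) * (1 - X * c)) = 0 := by
    linear_combination hsq - (1 - Y * c) ^ 2 * s1 + (1 - X * c) ^ 2 * s2
  rcases mul_eq_zero.1 key with h0 | h0
  · linarith
  · exfalso
    rw [abs_lt] at x1 x2
    rcases le_total 0 c with hc | hc
    · rw [abs_of_nonneg hc] at x1 x2
      have := mul_pos (sub_pos.2 x1.2) d2
      have := mul_pos (sub_pos.2 x2.2) d1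
      linarith
    · rw [abs_of_nonpos hc] at x1 x2
      have := mul_pos (a := X - c) (by linarith) d2
      have := mul_pos (a := Y - c) (by linarith) d1
      linarith

/-- The two radii differ only in the sign of sin ψ₀ cos (twist) in the denominator, so this product
must be zero. -/
theorem cos_twist_eq_zero_of_shadow_eq (H : IsAdmissible n a ψ₀) {u : ℝ}
    (hs : (ribbonPoint n a u ψ₀).shadow = (ribbonPoint n a (u + n) ψ₀).shadow) :
    Real.cos (twist n a u) = 0 := by
  rw [ribbonPoint_add_half H.n_pos H.odd, shadow_ribbonPoint, shadow_ribbonPoint,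
    Prod.mk.injEq] at hs
  have hr : ribbonRadius n a u ψ₀ = ribbonRadius n a u (-ψ₀) := by
    linear_combination Real.cos (longitude n u) * hs.1 + Real.sin (longitude n u) * hs.2 -
      (ribbonRadius n a u ψ₀ - ribbonRadius n a u (-ψ₀)) * Real.sin_sq_add_cos_sq (longitude n u)
  have c1 := H.cos_pos H.self_mem
  have d1 := sin_mul_cos_lt_one c1 (twist n a u)
  have d2 := sin_mul_cos_lt_one (ψ := -ψ₀) (by rwa [Real.cos_neg]) (twist n a u)
  rw [ribbonRadius, ribbonRadius, div_eq_div_iff d1.ne' d2.ne', Real.cos_neg] at hr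
  have := mul_left_cancel₀ c1.ne' hr
  rw [Real.sin_neg] at this
  have h2 : Real.sin ψ₀ * Real.cos (twist n a u) = 0 := by linarith
  exact (mul_eq_zero.1 h2).resolve_left H.sin_pos.ne'

end IsAdmissible

theorem height_of_cos_twist_eq_zero {ψ₀ u : ℝ} (hu : Real.cos (twist n a u) = 0) :
    (ribbonPoint n a u ψ₀).height = Real.sin ψ₀ * Real.sin (twist n a u) := by
  simp [height_ribbonPoint, hu]

/-! ### Smoothness and velocities of the shadows -/

theorem contDiff_boundary_shadow {ψ : ℝ} (h : 0 < Real.cos ψ) :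
    ContDiff ℝ ∞ fun u => (ribbonPoint n a u ψ).shadow := by
  simp only [shadow_ribbonPoint, ribbonRadius, longitude, twist]
  have hd : ∀ x : ℝ, 1 - Real.sin ψ *
      Real.cos (Real.pi * (2 * a * x + 1) / (2 * n) + Real.pi / 2) ≠ 0 :=
    fun x => (sin_mul_cos_lt_one h _).ne'
  fun_prop (disch := assumption)

theorem contDiff_boundary_height {ψ : ℝ} (h : 0 < Real.cos ψ) :
    ContDiff ℝ ∞ fun u => (ribbonPoint n a u ψ).height := by
  simp only [height_ribbonPoint, twist]
  have hd : ∀ x : ℝ, 1 - Real.sin ψ *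
      Real.cos (Real.pi * (2 * a * x + 1) / (2 * n) + Real.pi / 2) ≠ 0 :=
    fun x => (sin_mul_cos_lt_one h _).ne'
  fun_prop (disch := assumption)

theorem contDiffOn_section_shadow (u : ℝ) :
    ContDiffOn ℝ ∞ (fun ψ => (ribbonPoint n a u ψ).shadow) {ψ | 0 < Real.cos ψ} := by
  simp only [shadow_ribbonPoint, ribbonRadius]
  have hd : ∀ ψ ∈ {ψ | 0 < Real.cos ψ}, 1 - Real.sin ψ * Real.cos (twist n a u) ≠ 0 :=
    fun ψ h => (sin_mul_cos_lt_one h _).ne'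
  fun_prop (disch := assumption)

theorem contDiffOn_section_height (u : ℝ) :
    ContDiffOn ℝ ∞ (fun ψ => (ribbonPoint n a u ψ).height) {ψ | 0 < Real.cos ψ} := by
  simp only [height_ribbonPoint]
  have hd : ∀ ψ ∈ {ψ | 0 < Real.cos ψ}, 1 - Real.sin ψ * Real.cos (twist n a u) ≠ 0 :=
    fun ψ h => (sin_mul_cos_lt_one h _).ne'
  fun_prop (disch := assumption)

/-- The velocity of the shadow of the boundary of the ribbon. -/
noncomputable def boundaryVelocity (n : ℕ) (a : ℤ) (ψ u : ℝ) : ℝ × ℝ :=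
  let r' := -(Real.cos ψ * (Real.sin ψ * Real.sin (twist n a u) * (Real.pi * a / n))) /
    (1 - Real.sin ψ * Real.cos (twist n a u)) ^ 2
  (r' * Real.cos (longitude n u) +
      ribbonRadius n a u ψ * (-Real.sin (longitude n u) * (2 * Real.pi / n)),
    r' * Real.sin (longitude n u) +
      ribbonRadius n a u ψ * (Real.cos (longitude n u) * (2 * Real.pi / n)))

theorem hasDerivAt_boundary_shadow (hn : 0 < n) {ψ : ℝ} (h : 0 < Real.cos ψ) (u : ℝ) :
    HasDerivAt (fun u => (ribbonPoint n a u ψ).shadow) (boundaryVelocity n a ψ u) u := by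
  have hn' : (n : ℝ) ≠ 0 := by positivity
  have hl : HasDerivAt (longitude n) (2 * Real.pi / n) u := by
    have := ((hasDerivAt_id u).const_mul (2 * Real.pi)).div_const (n : ℝ)
    exact this.congr_deriv (by simp)
  have ht : HasDerivAt (twist n a) (Real.pi * a / n) u := by
    have := (((((hasDerivAt_id u).const_mul (2 * (a : ℝ))).add_const 1).const_mul
      Real.pi).div_const (2 * (n : ℝ))).add_const (Real.pi / 2)
    refine this.congr_deriv ?_
    field_simp
  have hd := sin_mul_cos_lt_one h (twist n a u)
  have hr : HasDerivAt (fun u => ribbonRadius n a u ψ)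
      (-(Real.cos ψ * (Real.sin ψ * Real.sin (twist n a u) * (Real.pi * a / n))) /
        (1 - Real.sin ψ * Real.cos (twist n a u)) ^ 2) u := by
    have := (hasDerivAt_const u (Real.cos ψ)).div
      ((ht.cos.const_mul (Real.sin ψ)).const_sub 1) hd.ne'
    refine this.congr_deriv ?_
    ring
  simp only [shadow_ribbonPoint]
  exact (hr.mul hl.cos).prodMk (hr.mul hl.sin)

/-- Its angular component is the radius times 2π / n, which is positive. -/
theorem boundaryVelocity_ne_zero (hn : 0 < n) {ψ : ℝ} (h : 0 < Real.cos ψ) (u : ℝ) :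
    boundaryVelocity n a ψ u ≠ 0 := by
  intro h0
  have hr := ribbonRadius_pos (n := n) (a := a) h u
  have e1 := congrArg Prod.fst h0
  have e2 := congrArg Prod.snd h0
  simp only [boundaryVelocity, Prod.fst_zero, Prod.snd_zero] at e1 e2
  have : ribbonRadius n a u ψ * (2 * Real.pi / n) = 0 := by
    linear_combination Real.cos (longitude n u) * e2 - Real.sin (longitude n u) * e1 -
      ribbonRadius n a u ψ * (2 * Real.pi / n) * Real.sin_sq_add_cos_sq (longitude n u)
  have hpi := Real.pi_pos
  have : 0 < ribbonRadius n a u ψ * (2 * Real.pi / n) := by positivity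
  linarith

theorem boundaryVelocity_add_period (hn : 0 < n) (ψ u : ℝ) (l : ℤ) :
    boundaryVelocity n a ψ (u + 2 * n * l) = boundaryVelocity n a ψ u := by
  have e1 := longitude_add_mul hn u (2 * l)
  have e2 := twist_add_mul (a := a) hn u (2 * l)
  have e3 : twist n a u + ((a * (2 * l) : ℤ) : ℝ) * Real.pi
      = twist n a u + ((a * l : ℤ) : ℝ) * (2 * Real.pi) := by push_cast; ring
  have e4 : u + 2 * n * l = u + n * ((2 * l : ℤ) : ℝ) := by push_cast; ring
  simp only [boundaryVelocity, ribbonRadius, e4, e1, e2, e3, Real.cos_add_int_mul_two_pi,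
    Real.sin_add_int_mul_two_pi]

theorem cos_twist_add_half (hn : 0 < n) (ha : Odd a) (u : ℝ) :
    Real.cos (twist n a (u + n)) = -Real.cos (twist n a u) := by
  have e2 := twist_add_mul (a := a) hn u 1
  simp only [Int.cast_one, mul_one] at e2
  obtain ⟨b, rfl⟩ := ha
  have e3 : twist n (2 * b + 1) u + ((2 * b + 1 : ℤ) : ℝ) * Real.pi
      = twist n (2 * b + 1) u + Real.pi + b * (2 * Real.pi) := by push_cast; ring
  rw [e2, e3, Real.cos_add_int_mul_two_pi, Real.cos_add_pi]

theorem sin_twist_add_half (hn : 0 < n) (ha : Odd a) (u : ℝ) :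
    Real.sin (twist n a (u + n)) = -Real.sin (twist n a u) := by
  have e2 := twist_add_mul (a := a) hn u 1
  simp only [Int.cast_one, mul_one] at e2
  obtain ⟨b, rfl⟩ := ha
  have e3 : twist n (2 * b + 1) u + ((2 * b + 1 : ℤ) : ℝ) * Real.pi
      = twist n (2 * b + 1) u + Real.pi + b * (2 * Real.pi) := by push_cast; ring
  rw [e2, e3, Real.sin_add_int_mul_two_pi, Real.sin_add_pi]

/-- The two boundary strands cross transversally where the ribbon is vertical. -/
theorem cross_boundaryVelocity (hn : 0 < n) (ha : Odd a) {ψ u : ℝ}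
    (hu : Real.cos (twist n a u) = 0) :
    cross (boundaryVelocity n a ψ u) (boundaryVelocity n a ψ (u + n)) =
      -(4 * Real.pi ^ 2 / n ^ 2 * Real.cos ψ ^ 2 * Real.sin ψ * Real.sin (twist n a u)) * a := by
  have e1 := longitude_add_mul hn u 1
  simp only [Int.cast_one, mul_one, one_mul] at e1
  -- At a vertical section both strands have radius cos ψ and the same angular velocity, while the
  -- radial velocities are opposite because the sine of the twist changes sign.
  simp only [cross, boundaryVelocity, ribbonRadius, cos_twist_add_half hn ha,
    sin_twist_add_half hn ha, hu, e1, Real.cos_add_two_pi, Real.sin_add_two_pi]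
  linear_combination -(4 * Real.pi ^ 2 / n ^ 2 * Real.cos ψ ^ 2 * Real.sin ψ *
    Real.sin (twist n a u)) * a * Real.sin_sq_add_cos_sq (longitude n u)

theorem hasDerivAt_section_shadow {ψ : ℝ} (h : 0 < Real.cos ψ) (u : ℝ) :
    HasDerivAt (fun ψ => (ribbonPoint n a u ψ).shadow)
      (((Real.cos (twist n a u) - Real.sin ψ) / (1 - Real.sin ψ * Real.cos (twist n a u)) ^ 2) •
        (Real.cos (longitude n u), Real.sin (longitude n u))) ψ := by
  have hd := sin_mul_cos_lt_one h (twist n a u)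
  have hr : HasDerivAt (fun ψ => ribbonRadius n a u ψ)
      ((Real.cos (twist n a u) - Real.sin ψ) /
        (1 - Real.sin ψ * Real.cos (twist n a u)) ^ 2) ψ := by
    have := (Real.hasDerivAt_cos ψ).div
      (((Real.hasDerivAt_sin ψ).mul_const (Real.cos (twist n a u))).const_sub 1) hd.ne'
    refine this.congr_deriv ?_
    congr 1
    linear_combination Real.cos (twist n a u) * Real.sin_sq_add_cos_sq ψ
  simp only [shadow_ribbonPoint]
  exact (hr.mul_const _).prodMk (hr.mul_const _)

/-- The radial speed vanishes only where sin ψ = cos (twist), which the bound `sin_lt` excludes. -/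
theorem IsAdmissible.section_velocity_ne_zero {ψ₀ ψ : ℝ} (H : IsAdmissible n a ψ₀)
    (h : ψ ∈ Set.Icc (-ψ₀) ψ₀) (k : ℤ) :
    ((Real.cos (twist n a k) - Real.sin ψ) / (1 - Real.sin ψ * Real.cos (twist n a k)) ^ 2) •
        (Real.cos (longitude n k), Real.sin (longitude n k)) ≠ 0 := by
  have hd := sin_mul_cos_lt_one (H.cos_pos h) (twist n a k)
  have x1 := (H.abs_sin_le h).trans_lt (H.sin_lt k)
  refine smul_ne_zero (div_ne_zero ?_ (by positivity)) ?_
  · intro h0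
    rw [sub_eq_zero.1 h0] at x1
    exact x1.false
  · intro h0
    have e1 := congrArg Prod.fst h0
    have e2 := congrArg Prod.snd h0
    have := Real.sin_sq_add_cos_sq (longitude n k)
    simp only [Prod.fst_zero, Prod.snd_zero] at e1 e2
    rw [e1, e2] at this
    norm_num at this

end Ribbon

end MobiusLadder

namespace MobiusLadder

/-! ### The Möbius ladder spanned by the twisted ribbon -/

open Classical in
/-- The map of the Möbius ladder that sends the outer circle to the boundary of the ribbon and the
rungs to cross sections of the ribbon. -/
noncomputable def ribbonMap (n : ℕ) (a : ℤ) (ψ₀ : ℝ) (p : ZMod (2 * n) → ℝ) : Sphere3 :=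
  if h : ∃ u, p = outerPoint n u then ribbonPoint n a h.choose ψ₀
  else if h : ∃ kt : ℤ × ℝ, p = rungPoint n kt.1 kt.2 then
    ribbonPoint n a h.choose.1 ((1 - 2 * h.choose.2) * ψ₀)
  else Sphere3.polar 0 0 0

namespace IsAdmissible

section Map

variable {n : ℕ} {a : ℤ} {ψ₀ : ℝ}

theorem ribbonMap_outerPoint (H : IsAdmissible n a ψ₀) (u : ℝ) :
    ribbonMap n a ψ₀ (outerPoint n u) = ribbonPoint n a u ψ₀ := by
  have h : ∃ u', outerPoint n u = outerPoint n u' := ⟨u, rfl⟩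
  rw [ribbonMap, dif_pos h]
  obtain ⟨l, hl⟩ := outerPoint_eq_outerPoint H.two_le h.choose_spec
  rw [hl, ribbonPoint_add_period H.n_pos]

/-- `ribbonMap` chooses some representation of the point: the ends of a rung fall into its outer
branch, and an inner point may be read from either end. Periodicity and `ribbonPoint_add_half`
reconcile these. -/
theorem ribbonMap_rungPoint (H : IsAdmissible n a ψ₀) (k : ℤ) (t : ℝ) :
    ribbonMap n a ψ₀ (rungPoint n k t) = ribbonPoint n a k ((1 - 2 * t) * ψ₀) := by
  by_cases h : ∃ u, rungPoint n k t = outerPoint n u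
  · obtain ⟨u, hu⟩ := h
    rw [hu, H.ribbonMap_outerPoint]
    obtain ⟨l, ⟨rfl, rfl⟩ | ⟨rfl, rfl⟩⟩ := rungPoint_eq_outerPoint H.two_le hu
    · rw [ribbonPoint_add_period H.n_pos]
      congr 1; ring
    · rw [ribbonPoint_add_period H.n_pos, ribbonPoint_add_half H.n_pos H.odd]
      congr 1; ring
  · have h' : ∃ kt : ℤ × ℝ, rungPoint n k t = rungPoint n kt.1 kt.2 := ⟨(k, t), rfl⟩
    rw [ribbonMap, dif_neg h, dif_pos h']
    obtain ⟨l, ⟨h1, h2⟩ | ⟨h1, h2⟩⟩ := rungPoint_eq_rungPoint H.two_le h'.choose_spec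
    · rw [h1, h2]
      push_cast
      rw [ribbonPoint_add_period H.n_pos]
    · rw [h1, h2]
      push_cast
      rw [ribbonPoint_add_period H.n_pos, ribbonPoint_add_half H.n_pos H.odd]
      congr 1; ring

theorem width_mem (H : IsAdmissible n a ψ₀) {t : ℝ} (ht : t ∈ Set.Icc (0 : ℝ) 1) :
    (1 - 2 * t) * ψ₀ ∈ Set.Icc (-ψ₀) ψ₀ := by
  have := H.pos
  constructor <;> nlinarith [ht.1, ht.2]

/-- Equal shadows force k' = k modulo n, hence the same rung, read forwards or backwards; there
`section_injective` applies. -/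
theorem eq_of_shadow_eq_of_rungPoint (H : IsAdmissible n a ψ₀) {k k' : ℤ} {t t' : ℝ}
    (ht : t ∈ Set.Icc (0 : ℝ) 1) (ht' : t' ∈ Set.Icc (0 : ℝ) 1)
    (h : (ribbonMap n a ψ₀ (rungPoint n k t)).shadow =
      (ribbonMap n a ψ₀ (rungPoint n k' t')).shadow) : rungPoint n k t = rungPoint n k' t' := by
  have inj : ∀ {s s' : ℝ}, s ∈ Set.Icc (0 : ℝ) 1 → s' ∈ Set.Icc (0 : ℝ) 1 →
      (ribbonMap n a ψ₀ (rungPoint n k s)).shadow = (ribbonMap n a ψ₀ (rungPoint n k s')).shadow →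
      rungPoint n k s = rungPoint n k s' := by
    intro s s' hs hs' h
    rw [H.ribbonMap_rungPoint, H.ribbonMap_rungPoint] at h
    have := mul_right_cancel₀ H.pos.ne' (H.section_injective (H.width_mem hs) (H.width_mem hs') h)
    rw [show s = s' by linarith]
  have h0 := h
  rw [H.ribbonMap_rungPoint, H.ribbonMap_rungPoint] at h0
  obtain ⟨l, hl⟩ := shadow_ribbonPoint_eq H.n_pos (H.cos_pos (H.width_mem ht))
    (H.cos_pos (H.width_mem ht')) h0
  have hl : k' = k + n * l := by exact_mod_cast hl
  rcases Int.even_or_odd' l with ⟨d, rfl | rfl⟩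
  · obtain rfl : k' = k + 2 * n * d := by rw [hl]; ring
    rw [rungPoint_add_period] at h ⊢
    exact inj ht ht' h
  · obtain rfl : k' = k + n + 2 * n * d := by rw [hl]; ring
    rw [rungPoint_add_period, rungPoint_add_half] at h ⊢
    exact inj ht ⟨by linarith [ht'.2], by linarith [ht'.1]⟩ h

/-- Since u = k modulo n, the parameter u is an integer, so the outer point is a vertex and thus
itself the start of a rung. -/
theorem eq_of_shadow_eq_of_outerPoint_rungPoint (H : IsAdmissible n a ψ₀) {u t : ℝ} {k : ℤ}
    (ht : t ∈ Set.Icc (0 : ℝ) 1)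
    (h : (ribbonMap n a ψ₀ (outerPoint n u)).shadow =
      (ribbonMap n a ψ₀ (rungPoint n k t)).shadow) : outerPoint n u = rungPoint n k t := by
  have h0 := h
  rw [H.ribbonMap_rungPoint, H.ribbonMap_outerPoint] at h0
  obtain ⟨l, hl⟩ := shadow_ribbonPoint_eq H.n_pos (H.cos_pos H.self_mem)
    (H.cos_pos (H.width_mem ht)) h0
  obtain rfl : u = ((k - n * l : ℤ) : ℝ) := by push_cast; linarith
  rw [← rungPoint_zero] at h ⊢
  exact H.eq_of_shadow_eq_of_rungPoint (by simp) ht h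

theorem eq_or_crossing_of_outerPoint (H : IsAdmissible n a ψ₀) {u u' : ℝ}
    (h : (ribbonMap n a ψ₀ (outerPoint n u)).shadow =
      (ribbonMap n a ψ₀ (outerPoint n u')).shadow) :
    outerPoint n u = outerPoint n u' ∨
      (Real.cos (twist n a u) = 0 ∧ outerPoint n u' = outerPoint n (u + n)) := by
  have h0 := h
  rw [H.ribbonMap_outerPoint, H.ribbonMap_outerPoint] at h0
  obtain ⟨l, hl⟩ := shadow_ribbonPoint_eq H.n_pos (H.cos_pos H.self_mem)
    (H.cos_pos H.self_mem) h0
  rcases Int.even_or_odd' l with ⟨d, rfl | rfl⟩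
  · obtain rfl : u' = u + 2 * n * d := by rw [hl]; push_cast; ring
    left
    rw [outerPoint_add_period]
  · obtain rfl : u' = u + n + 2 * n * d := by rw [hl]; push_cast; ring
    right
    rw [outerPoint_add_period] at h ⊢
    rw [H.ribbonMap_outerPoint, H.ribbonMap_outerPoint] at h
    exact ⟨H.cos_twist_eq_zero_of_shadow_eq h, rfl⟩

/-- Two points with the same shadow either agree, or are the two boundary points of a cross section
at which the ribbon is vertical. -/
theorem eq_or_crossing (H : IsAdmissible n a ψ₀) {p q : (graph n).realization}
    (h : (ribbonMap n a ψ₀ p).shadow = (ribbonMap n a ψ₀ q).shadow) :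
    p = q ∨ ∃ u, Real.cos (twist n a u) = 0 ∧ p.1 = outerPoint n u ∧
      q.1 = outerPoint n (u + n) := by
  rcases exists_outerPoint_or_rungPoint H.two_le p with ⟨u, hp⟩ | ⟨k, t, ht, hp⟩ <;>
    rcases exists_outerPoint_or_rungPoint H.two_le q with ⟨u', hq⟩ | ⟨k', t', ht', hq⟩ <;>
    rw [hp, hq] at h
  · rcases H.eq_or_crossing_of_outerPoint h with h | ⟨h1, h2⟩
    · exact Or.inl (Subtype.ext (by rw [hp, hq, h]))
    · exact Or.inr ⟨u, h1, hp, by rw [hq, h2]⟩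
  · exact Or.inl (Subtype.ext (by rw [hp, hq, H.eq_of_shadow_eq_of_outerPoint_rungPoint ht' h]))
  · exact Or.inl (Subtype.ext
      (by rw [hp, hq, H.eq_of_shadow_eq_of_outerPoint_rungPoint ht h.symm]))
  · exact Or.inl (Subtype.ext (by rw [hp, hq, H.eq_of_shadow_eq_of_rungPoint ht ht' h]))

/-- Where shadows coincide at distinct points, the heights are opposite and nonzero. -/
theorem ribbonMap_injective (H : IsAdmissible n a ψ₀) :
    Function.Injective fun p : (graph n).realization => ribbonMap n a ψ₀ p := by
  intro p q h
  rcases H.eq_or_crossing (congrArg Sphere3.shadow h) with h' | ⟨u, hu, hp, hq⟩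
  · exact h'
  · exfalso
    have hh := congrArg Sphere3.height h
    have hu' : Real.cos (twist n a (u + n)) = 0 := by
      rw [cos_twist_add_half H.n_pos H.odd, hu, neg_zero]
    simp only [hp, hq, H.ribbonMap_outerPoint, height_of_cos_twist_eq_zero hu,
      height_of_cos_twist_eq_zero hu', sin_twist_add_half H.n_pos H.odd] at hh
    have h1 := Real.sin_sq_add_cos_sq (twist n a u)
    have h2 : Real.sin ψ₀ * Real.sin (twist n a u) = 0 := by linarith
    rw [hu, (mul_eq_zero.1 h2).resolve_left H.sin_pos.ne'] at h1
    norm_num at h1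

end Map

/-! ### The embedding and its regular projection -/

section Edges

variable {N : ℕ} {a : ℤ} {ψ₀ : ℝ}

theorem ribbonMap_point_inl (H : IsAdmissible (2 * N + 1) a ψ₀) (i : Fin (2 * (2 * N + 1))) {t : ℝ}
    (ht : t ∈ Set.Icc (0 : ℝ) 1) :
    ribbonMap (2 * N + 1) a ψ₀ (Edge.point (Sum.inl i : Edge N) t) =
      ribbonPoint (2 * N + 1) a (outerParam i t) ψ₀ := by
  rw [Edge.point_inl i ht, H.ribbonMap_outerPoint]

theorem ribbonMap_point_inr (H : IsAdmissible (2 * N + 1) a ψ₀) (j : Fin (2 * N + 1)) {t : ℝ}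
    (ht : t ∈ Set.Icc (0 : ℝ) 1) :
    ribbonMap (2 * N + 1) a ψ₀ (Edge.point (Sum.inr j : Edge N) t) =
      ribbonPoint (2 * N + 1) a (j : ℕ) ((1 - 2 * rungParam j t) * ψ₀) := by
  rw [Edge.point_inr j ht, H.ribbonMap_rungPoint]
  simp

theorem continuous_ribbonPoint {n : ℕ} :
    Continuous fun x : ℝ × ℝ => ribbonPoint n a x.1 x.2 := by
  refine Continuous.subtype_mk ?_ _
  refine (PiLp.continuous_toLp 2 _).comp (continuous_pi fun i => ?_)
  unfold longitude twist
  fin_cases i <;> simp <;> fun_prop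

theorem continuous_outerParam (i : ℕ) : Continuous (outerParam i) := by
  unfold outerParam; split_ifs <;> fun_prop

theorem continuous_rungParam (i : ℕ) : Continuous (rungParam i) := by
  unfold rungParam; split_ifs <;> fun_prop

/-- The realization is a quotient of finitely many closed intervals, so continuity can be tested on
each edge despite the definition by choice. Compactness and injectivity do the rest. -/
theorem isEmbedding (H : IsAdmissible (2 * N + 1) a ψ₀) :
    Topology.IsEmbedding fun p : Space N => ribbonMap (2 * N + 1) a ψ₀ p := by
  have hN : 1 ≤ N := by have := H.two_le; omega
  let E : Edge N × unitInterval → Space N := fun x => x.1.point x.2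
  have hE : Continuous E := continuous_prod_of_discrete_left.2 fun e =>
    e.continuous_point.comp continuous_subtype_val
  have hsurj : Function.Surjective E := fun p => by
    obtain ⟨e, t, ht, h⟩ := Edge.exists_point_eq hN p
    exact ⟨(e, ⟨t, ht⟩), h⟩
  have hq : Topology.IsQuotientMap E := hE.isClosedMap.isQuotientMap hE hsurj
  have hcomp : CompactSpace (Space N) := hsurj.compactSpace hE
  have hcont : Continuous fun p : Space N => ribbonMap (2 * N + 1) a ψ₀ p := by
    rw [hq.continuous_iff, continuous_prod_of_discrete_left]
    rintro (i | j)
    · have h1 : Continuous fun t : unitInterval => outerParam i t :=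
        (continuous_outerParam i).comp continuous_subtype_val
      have h2 : Continuous fun t : unitInterval => (outerParam i t, ψ₀) := by fun_prop
      exact ((continuous_ribbonPoint (n := 2 * N + 1) (a := a)).comp h2).congr
        fun t => (H.ribbonMap_point_inl i t.2).symm
    · have h1 : Continuous fun t : unitInterval => rungParam j t :=
        (continuous_rungParam j).comp continuous_subtype_val
      have h2 : Continuous fun t : unitInterval =>
          (((j : ℕ) : ℝ), (1 - 2 * rungParam j t) * ψ₀) := by fun_prop
      exact ((continuous_ribbonPoint (n := 2 * N + 1) (a := a)).comp h2).congr
        fun t => (H.ribbonMap_point_inr j t.2).symm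
  exact (hcont.isClosedEmbedding H.ribbonMap_injective).isEmbedding

theorem hasDerivAt_outerParam (i : ℕ) (t : ℝ) :
    HasDerivAt (outerParam i) (if Even i then 1 else -1) t := by
  unfold outerParam
  split_ifs
  · exact (hasDerivAt_id t).const_add _
  · exact (hasDerivAt_id t).const_sub _

theorem hasDerivAt_rungParam (j : ℕ) (t : ℝ) :
    HasDerivAt (rungParam j) (if Even j then -1 else 1) t := by
  unfold rungParam
  split_ifs
  · exact (hasDerivAt_id t).const_sub _
  · exact hasDerivAt_id t

theorem contDiff_outerParam (i : ℕ) : ContDiff ℝ ∞ (outerParam i) := by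
  unfold outerParam; split_ifs <;> fun_prop

theorem contDiff_rungParam (i : ℕ) : ContDiff ℝ ∞ (rungParam i) := by
  unfold rungParam; split_ifs <;> fun_prop

theorem ribbonPoint_ne_pole {n : ℕ} {ψ : ℝ} (h : 0 < Real.cos ψ) (u : ℝ) :
    (ribbonPoint n a u ψ : EuclideanSpace ℝ (Fin 4)) 3 ≠ 1 := by
  have := sin_mul_cos_lt_one h (twist n a u)
  have e : (ribbonPoint n a u ψ : EuclideanSpace ℝ (Fin 4)) 3 =
    Real.sin ψ * Real.cos (twist n a u) := by simp [ribbonPoint, Sphere3.polar]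
  rw [e]
  linarith

theorem cast_ne_zero (H : IsAdmissible (2 * N + 1) a ψ₀) : (a : ℝ) ≠ 0 := by
  have := H.odd
  intro h
  rw [Int.cast_eq_zero.1 h] at this
  simp at this

theorem finite_crossings (H : IsAdmissible (2 * N + 1) a ψ₀) :
    {pq : Space N × Space N | pq.1 ≠ pq.2 ∧ (ribbonMap (2 * N + 1) a ψ₀ pq.1).shadow =
      (ribbonMap (2 * N + 1) a ψ₀ pq.2).shadow}.Finite := by
  classical
  have hn := H.n_pos
  have ha := H.cast_ne_zero
  set n := 2 * N + 1 with hn_def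
  let S : Set ℝ := {u | u ∈ Set.Ico (0 : ℝ) (2 * n) ∧ Real.cos (twist n a u) = 0}
  have hS : S.Finite := by
    -- On one period |2au + 1| ≤ 4n|a| + 1, so 2au + 1 = 2nl forces |l| ≤ 2|a| + 1.
    refine Set.Finite.subset ((Finset.Icc (-(2 * |a| + 1)) (2 * |a| + 1)).finite_toSet.image
      fun l : ℤ => (2 * n * l - 1 : ℝ) / (2 * a)) ?_
    rintro u ⟨hu, hc⟩
    obtain ⟨l, hl⟩ := (cos_twist_eq_zero_iff hn).1 hc
    refine ⟨l, ?_, by field_simp; linarith⟩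
    rw [Finset.coe_Icc, Set.mem_Icc, ← abs_le]
    have hn1 : (1 : ℝ) ≤ n := by exact_mod_cast hn
    have h1 : |(2 * n * l : ℝ)| ≤ 2 * |(a : ℝ)| * (2 * n) + 1 := by
      rw [← hl]
      refine (abs_add_le _ _).trans ?_
      rw [abs_mul, abs_mul, abs_two, abs_one, abs_of_nonneg hu.1]
      have := mul_le_mul_of_nonneg_left hu.2.le (abs_nonneg (a : ℝ))
      linarith
    rw [abs_mul, abs_mul, abs_two, Nat.abs_cast] at h1
    have h2 : (|(l : ℝ)|) ≤ 2 * |(a : ℝ)| + 1 := by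
      by_contra! h
      have := mul_lt_mul_of_pos_left h (by linarith : (0 : ℝ) < 2 * n)
      linarith
    exact_mod_cast h2
  have hN : 1 ≤ N := by have := H.two_le; omega
  let P : ℝ → Space N := fun u =>
    if h : outerPoint n u ∈ (graph n).realization then ⟨outerPoint n u, h⟩
    else (graph n).vertexPoint 0
  have hP : ∀ {p : Space N} {u : ℝ}, p.1 = outerPoint n u → p = P u := by
    intro p u h
    have hm : outerPoint n u ∈ (graph n).realization := h ▸ p.2
    exact Subtype.ext (by simp only [P, dif_pos hm, h])
  refine (hS.image fun u => (P u, P (u + n))).subset ?_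
  rintro ⟨p, q⟩ ⟨hne, hpq⟩
  rcases H.eq_or_crossing hpq with h | ⟨u, hu, h1, h2⟩
  · exact absurd h hne
  · have hn' : (0 : ℝ) < 2 * n := by positivity
    have hu' := toIcoMod_mem_Ico hn' 0 u
    rw [zero_add] at hu'
    have e : toIcoMod hn' 0 u = u + 2 * n * (-toIcoDiv hn' 0 u : ℤ) := by
      rw [toIcoMod, zsmul_eq_mul]; push_cast; ring
    refine ⟨toIcoMod hn' 0 u, ⟨hu', ?_⟩, ?_⟩
    · rw [e, cos_twist_add_period hn, hu]
    · refine Prod.ext (hP ?_).symm (hP ?_).symm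
      · rw [e, outerPoint_add_period, h1]
      · rw [e, add_right_comm, outerPoint_add_period, h2]

theorem edgeShadow_inl (H : IsAdmissible (2 * N + 1) a ψ₀) (i : Fin (2 * (2 * N + 1))) {t : ℝ}
    (ht : t ∈ Set.Icc (0 : ℝ) 1) :
    edgeShadow (fun p : Space N => ribbonMap (2 * N + 1) a ψ₀ p) (Sum.inl i) t =
      (ribbonPoint (2 * N + 1) a (outerParam i t) ψ₀).shadow := by
  rw [edgeShadow, H.ribbonMap_point_inl i ht]

theorem edgeHeight_inl (H : IsAdmissible (2 * N + 1) a ψ₀) (i : Fin (2 * (2 * N + 1))) {t : ℝ}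
    (ht : t ∈ Set.Icc (0 : ℝ) 1) :
    edgeHeight (fun p : Space N => ribbonMap (2 * N + 1) a ψ₀ p) (Sum.inl i) t =
      (ribbonPoint (2 * N + 1) a (outerParam i t) ψ₀).height := by
  rw [edgeHeight, H.ribbonMap_point_inl i ht]

theorem edgeShadow_inr (H : IsAdmissible (2 * N + 1) a ψ₀) (j : Fin (2 * N + 1)) {t : ℝ}
    (ht : t ∈ Set.Icc (0 : ℝ) 1) :
    edgeShadow (fun p : Space N => ribbonMap (2 * N + 1) a ψ₀ p) (Sum.inr j) t =
      (ribbonPoint (2 * N + 1) a (j : ℕ) ((1 - 2 * rungParam j t) * ψ₀)).shadow := by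
  rw [edgeShadow, H.ribbonMap_point_inr j ht]

theorem edgeHeight_inr (H : IsAdmissible (2 * N + 1) a ψ₀) (j : Fin (2 * N + 1)) {t : ℝ}
    (ht : t ∈ Set.Icc (0 : ℝ) 1) :
    edgeHeight (fun p : Space N => ribbonMap (2 * N + 1) a ψ₀ p) (Sum.inr j) t =
      (ribbonPoint (2 * N + 1) a (j : ℕ) ((1 - 2 * rungParam j t) * ψ₀)).height := by
  rw [edgeHeight, H.ribbonMap_point_inr j ht]

theorem hasDerivAt_outer_shadow (H : IsAdmissible (2 * N + 1) a ψ₀) (i : ℕ) (t : ℝ) :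
    HasDerivAt (fun t => (ribbonPoint (2 * N + 1) a (outerParam i t) ψ₀).shadow)
      ((if Even i then 1 else -1 : ℝ) • boundaryVelocity (2 * N + 1) a ψ₀ (outerParam i t)) t :=
  (hasDerivAt_boundary_shadow H.n_pos (H.cos_pos H.self_mem) (outerParam i t)).scomp t
    (hasDerivAt_outerParam i t)

theorem deriv_edgeShadow_inl (H : IsAdmissible (2 * N + 1) a ψ₀) (i : Fin (2 * (2 * N + 1)))
    {t : ℝ} (ht : t ∈ Set.Ioo (0 : ℝ) 1) :
    deriv (edgeShadow (fun p : Space N => ribbonMap (2 * N + 1) a ψ₀ p) (Sum.inl i)) t =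
      (if Even (i : ℕ) then 1 else -1 : ℝ) •
        boundaryVelocity (2 * N + 1) a ψ₀ (outerParam i t) := by
  refine HasDerivAt.deriv ((H.hasDerivAt_outer_shadow i t).congr_of_eventuallyEq ?_)
  filter_upwards [Ioo_mem_nhds ht.1 ht.2] with s hs
  exact H.edgeShadow_inl i (Set.Ioo_subset_Icc_self hs)

theorem immersed_edge (H : IsAdmissible (2 * N + 1) a ψ₀) (e : Edge N) {t : ℝ}
    (ht : t ∈ Set.Icc (0 : ℝ) 1) :
    derivWithin (edgeShadow (fun p : Space N => ribbonMap (2 * N + 1) a ψ₀ p) e)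
      (Set.Icc 0 1) t ≠ 0 := by
  have hU := uniqueDiffOn_Icc (zero_lt_one' ℝ) t ht
  rcases e with i | j
  · have := ((H.hasDerivAt_outer_shadow i t).hasDerivWithinAt (s := Set.Icc 0 1)).congr
      (fun s hs => H.edgeShadow_inl i hs) (H.edgeShadow_inl i ht)
    rw [this.derivWithin hU]
    refine smul_ne_zero (by split_ifs <;> norm_num) ?_
    exact boundaryVelocity_ne_zero H.n_pos (H.cos_pos H.self_mem) _
  · have hm := H.width_mem (rungParam_mem_Icc j ht)
    have hg := (((hasDerivAt_rungParam j t).const_mul 2).const_sub 1).mul_const ψ₀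
    have hd := (hasDerivAt_section_shadow (n := 2 * N + 1) (a := a) (H.cos_pos hm)
      ((j : ℕ) : ℝ)).scomp t hg
    have := (hd.hasDerivWithinAt (s := Set.Icc 0 1)).congr
      (fun s hs => H.edgeShadow_inr j hs) (H.edgeShadow_inr j ht)
    rw [this.derivWithin hU]
    refine smul_ne_zero ?_ (by simpa using H.section_velocity_ne_zero hm (j : ℕ))
    have := H.pos.ne'
    split_ifs <;> simp [this]

theorem outerPoint_ne_of_rung (H : IsAdmissible (2 * N + 1) a ψ₀) (j : Fin (2 * N + 1)) {t u : ℝ}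
    (ht : t ∈ Set.Ioo (0 : ℝ) 1) :
    (Edge.point (Sum.inr j : Edge N) t).1 ≠ outerPoint (2 * N + 1) u := by
  rw [Edge.point_inr j (Set.Ioo_subset_Icc_self ht)]
  intro h
  have h1 := rungParam_mem_Ioo j ht
  obtain ⟨l, h | h⟩ := rungPoint_eq_outerPoint H.two_le h
  · linarith [h1.1, h.2]
  · linarith [h1.2, h.2]

/-- A crossing of the interiors of two edges involves two outer edges, at points half a turn
apart. -/
theorem crossing_edges (H : IsAdmissible (2 * N + 1) a ψ₀) {e e' : Edge N} {s t : ℝ}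
    (hs : s ∈ Set.Ioo (0 : ℝ) 1) (ht : t ∈ Set.Ioo (0 : ℝ) 1) (hne : e.point s ≠ e'.point t)
    (h : edgeShadow (fun p : Space N => ribbonMap (2 * N + 1) a ψ₀ p) e s =
      edgeShadow (fun p : Space N => ribbonMap (2 * N + 1) a ψ₀ p) e' t) :
    ∃ i j, e = Sum.inl i ∧ e' = Sum.inl j ∧
      Real.cos (twist (2 * N + 1) a (outerParam i s)) = 0 ∧
      ∃ l : ℤ, outerParam j t =
        outerParam i s + (2 * N + 1 : ℕ) + 2 * (2 * N + 1 : ℕ) * l := by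
  rcases H.eq_or_crossing h with h | ⟨u, hu, h1, h2⟩
  · exact absurd h hne
  rcases e with i | i
  · rcases e' with j | j
    · rw [Edge.point_inl i (Set.Ioo_subset_Icc_self hs)] at h1
      rw [Edge.point_inl j (Set.Ioo_subset_Icc_self ht)] at h2
      obtain ⟨l, rfl⟩ := outerPoint_eq_outerPoint H.two_le h1
      obtain ⟨l', hl'⟩ := outerPoint_eq_outerPoint H.two_le h2
      refine ⟨i, j, rfl, rfl, ?_, l - l', ?_⟩
      · rwa [cos_twist_add_period H.n_pos] at hu
      · push_cast at hl' ⊢; linarith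
    · exact absurd h2 (H.outerPoint_ne_of_rung j ht)
  · exact absurd h1 (H.outerPoint_ne_of_rung i hs)

theorem cross_smul (x y : ℝ) (v w : ℝ × ℝ) : cross (x • v) (y • w) = x * y * cross v w := by
  simp only [cross, Prod.smul_fst, Prod.smul_snd, smul_eq_mul]; ring

theorem sin_twist_ne_zero {n : ℕ} {u : ℝ} (h : Real.cos (twist n a u) = 0) :
    Real.sin (twist n a u) ≠ 0 := by
  intro h'
  have := Real.sin_sq_add_cos_sq (twist n a u)
  rw [h, h'] at this
  norm_num at this

theorem hasRegularProjection (H : IsAdmissible (2 * N + 1) a ψ₀) :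
    HasRegularProjection fun p : Space N => ribbonMap (2 * N + 1) a ψ₀ p where
  ne_pole p := by
    rcases exists_outerPoint_or_rungPoint H.two_le p with ⟨u, hp⟩ | ⟨k, t, ht, hp⟩
    · rw [hp, H.ribbonMap_outerPoint]
      exact ribbonPoint_ne_pole (H.cos_pos H.self_mem) _
    · rw [hp, H.ribbonMap_rungPoint]
      exact ribbonPoint_ne_pole (H.cos_pos (H.width_mem ht)) _
  smooth_shadow e := by
    rcases e with i | j
    · exact ((contDiff_boundary_shadow (H.cos_pos H.self_mem)).comp
        (contDiff_outerParam i)).contDiffOn.congr fun t ht => H.edgeShadow_inl i ht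
    · have hr := contDiff_rungParam j
      have hg : ContDiff ℝ ∞ fun t => (1 - 2 * rungParam j t) * ψ₀ := by fun_prop
      exact ((contDiffOn_section_shadow _).comp hg.contDiffOn fun t ht =>
        H.cos_pos (H.width_mem (rungParam_mem_Icc j ht))).congr fun t ht => H.edgeShadow_inr j ht
  smooth_height e := by
    rcases e with i | j
    · exact ((contDiff_boundary_height (H.cos_pos H.self_mem)).comp
        (contDiff_outerParam i)).contDiffOn.congr fun t ht => H.edgeHeight_inl i ht
    · have hr := contDiff_rungParam j
      have hg : ContDiff ℝ ∞ fun t => (1 - 2 * rungParam j t) * ψ₀ := by fun_prop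
      exact ((contDiffOn_section_height _).comp hg.contDiffOn fun t ht =>
        H.cos_pos (H.width_mem (rungParam_mem_Icc j ht))).congr fun t ht => H.edgeHeight_inr j ht
  immersed e t ht := H.immersed_edge e ht
  finite_multiple := H.finite_crossings
  no_triple p q r h1 h2 := by
    rcases H.eq_or_crossing h1 with h | ⟨u, hu, hp, hq⟩
    · exact Or.inl h
    rcases H.eq_or_crossing h2 with h | ⟨u', hu', hq', hr⟩
    · exact Or.inr (Or.inl h)
    -- Passing through two crossings moves the parameter by 2n, a full period, so p = r.
    right; right
    rw [hq] at hq'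
    obtain ⟨l, rfl⟩ := outerPoint_eq_outerPoint H.two_le hq'
    refine Subtype.ext ?_
    rw [hp, hr, ← outerPoint_add_period u (1 + l)]
    congr 1
    push_cast; ring
  vertex_simple v q h := by
    rcases H.eq_or_crossing h with h | ⟨u, hu, hp, hq⟩
    · exact h
    exfalso
    obtain ⟨k, rfl⟩ := ZMod.intCast_surjective v
    have e : outerPoint (2 * N + 1) k = outerPoint (2 * N + 1) u := by
      rw [outerPoint_intCast, ← hp]; rfl
    obtain ⟨l, rfl⟩ := outerPoint_eq_outerPoint H.two_le e
    rw [cos_twist_add_period H.n_pos] at hu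
    exact cos_twist_intCast_ne_zero H.n_pos k hu
  transverse e e' s hs t ht hne h := by
    obtain ⟨i, j, rfl, rfl, hc, l, hl⟩ := H.crossing_edges hs ht hne h
    rw [H.deriv_edgeShadow_inl i hs, H.deriv_edgeShadow_inl j ht, cross_smul, hl,
      boundaryVelocity_add_period H.n_pos, cross_boundaryVelocity H.n_pos H.odd hc]
    have h1 := sin_twist_ne_zero hc
    have h2 := H.sin_pos.ne'
    have h3 := (H.cos_pos H.self_mem).ne'
    have h4 := H.cast_ne_zero
    have h5 := Real.pi_ne_zero
    have h6 : ((2 * N + 1 : ℕ) : ℝ) ≠ 0 := by positivity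
    refine mul_ne_zero (mul_ne_zero (by split_ifs <;> norm_num) (by split_ifs <;> norm_num))
      (mul_ne_zero (neg_ne_zero.2 ?_) h4)
    positivity

end Edges

end IsAdmissible

end MobiusLadder

/-! ### Symmetries of the three-sphere -/

namespace Sphere3

/-- The rotation of `S³ ⊆ ℂ²` by the angles `β` and `γ` in the two coordinates. -/
noncomputable def rotate (β γ : ℝ) (q : Sphere3) : Sphere3 :=
  ⟨!₂[Real.cos β * q.1 0 - Real.sin β * q.1 1, Real.sin β * q.1 0 + Real.cos β * q.1 1,
    Real.cos γ * q.1 2 + Real.sin γ * q.1 3, Real.cos γ * q.1 3 - Real.sin γ * q.1 2], by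
    have h := q.2
    rw [mem_sphere_zero_iff_norm, EuclideanSpace.norm_eq, Real.sqrt_eq_one] at h ⊢
    simp only [Fin.sum_univ_four, Real.norm_eq_abs, sq_abs] at h ⊢
    simp
    linear_combination h + (q.1 0 ^ 2 + q.1 1 ^ 2) * Real.sin_sq_add_cos_sq β +
      (q.1 2 ^ 2 + q.1 3 ^ 2) * Real.sin_sq_add_cos_sq γ⟩

/-- Complex conjugation of both coordinates of `S³ ⊆ ℂ²`. -/
noncomputable def conjugate (q : Sphere3) : Sphere3 :=
  ⟨!₂[q.1 0, -q.1 1, -q.1 2, q.1 3], by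
    have h := q.2
    rw [mem_sphere_zero_iff_norm, EuclideanSpace.norm_eq, Real.sqrt_eq_one] at h ⊢
    simp only [Fin.sum_univ_four, Real.norm_eq_abs, sq_abs] at h ⊢
    simpa using h⟩

theorem continuous_rotate (β γ : ℝ) : Continuous (rotate β γ) := by
  refine Continuous.subtype_mk ?_ _
  refine (PiLp.continuous_toLp 2 _).comp (continuous_pi fun i => ?_)
  fin_cases i <;> simp <;> fun_prop

theorem continuous_conjugate : Continuous conjugate := by
  refine Continuous.subtype_mk ?_ _
  refine (PiLp.continuous_toLp 2 _).comp (continuous_pi fun i => ?_)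
  fin_cases i <;> simp <;> fun_prop

theorem rotate_neg_rotate (β γ : ℝ) (q : Sphere3) : rotate (-β) (-γ) (rotate β γ q) = q := by
  apply Subtype.ext
  ext i
  fin_cases i <;> simp [rotate]
  · linear_combination q.1 0 * Real.sin_sq_add_cos_sq β
  · linear_combination q.1 1 * Real.sin_sq_add_cos_sq β
  · linear_combination q.1 2 * Real.sin_sq_add_cos_sq γ
  · linear_combination q.1 3 * Real.sin_sq_add_cos_sq γ

theorem conjugate_conjugate (q : Sphere3) : conjugate (conjugate q) = q := by
  apply Subtype.ext
  ext i
  fin_cases i <;> simp [conjugate]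

/-- `Sphere3.rotate` as a homeomorphism. -/
noncomputable def rotateHomeomorph (β γ : ℝ) : Sphere3 ≃ₜ Sphere3 where
  toFun := rotate β γ
  invFun := rotate (-β) (-γ)
  left_inv := rotate_neg_rotate β γ
  right_inv q := by simpa using rotate_neg_rotate (-β) (-γ) q
  continuous_toFun := continuous_rotate β γ
  continuous_invFun := continuous_rotate _ _

/-- `Sphere3.conjugate` as a homeomorphism. -/
noncomputable def conjugateHomeomorph : Sphere3 ≃ₜ Sphere3 where
  toFun := conjugate
  invFun := conjugate
  left_inv := conjugate_conjugate
  right_inv := conjugate_conjugate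
  continuous_toFun := continuous_conjugate
  continuous_invFun := continuous_conjugate

theorem rotate_polar (β γ θ φ ψ : ℝ) : rotate β γ (polar θ φ ψ) = polar (θ + β) (φ + γ) ψ := by
  apply Subtype.ext
  ext i
  fin_cases i <;> simp [rotate, polar, Real.cos_add, Real.sin_add] <;> ring

theorem conjugate_polar (θ φ ψ : ℝ) : conjugate (polar θ φ ψ) = polar (-θ) (-φ) ψ := by
  apply Subtype.ext
  ext i
  fin_cases i <;> simp [conjugate, polar]

end Sphere3

/-! ### Symmetries of the sphere acting on the ladder -/

namespace MobiusLadder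

theorem rotate_ribbonPoint {n : ℕ} (hn : 0 < n) (a : ℤ) (c u ψ : ℝ) :
    Sphere3.rotate (longitude n c) (Real.pi * a * c / n) (ribbonPoint n a u ψ) =
      ribbonPoint n a (u + c) ψ := by
  have : (n : ℝ) ≠ 0 := by positivity
  rw [ribbonPoint, Sphere3.rotate_polar, ribbonPoint]
  congr 1
  · unfold longitude; field_simp
  · unfold twist; field_simp; ring

/-- As `twist` is affine in u, -twist u + (twist c + twist 0) = twist (c - u); the term at 0
compensates the constant that conjugation negates. -/
theorem rotate_conjugate_ribbonPoint {n : ℕ} (hn : 0 < n) (a : ℤ) (c u ψ : ℝ) :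
    Sphere3.rotate (longitude n c) (twist n a c + twist n a 0)
      (Sphere3.conjugate (ribbonPoint n a u ψ)) = ribbonPoint n a (c - u) ψ := by
  have : (n : ℝ) ≠ 0 := by positivity
  rw [ribbonPoint, Sphere3.conjugate_polar, Sphere3.rotate_polar, ribbonPoint]
  congr 1
  · unfold longitude; field_simp; ring
  · unfold twist; field_simp; ring

namespace IsAdmissible

variable {N : ℕ} {a : ℤ} {ψ₀ : ℝ}

theorem isInducedBy_of_apply {f : Space N → Sphere3}
    {α : graph (2 * N + 1) ≃g graph (2 * N + 1)} {h : Sphere3 ≃ₜ Sphere3}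
    (H : ∀ p, h (f p) = f ((graph (2 * N + 1)).realizationMap α p)) : IsInducedBy f α h := by
  refine ⟨Set.Subset.antisymm ?_ ?_, H⟩
  · rintro _ ⟨_, ⟨p, rfl⟩, rfl⟩
    exact ⟨_, (H p).symm⟩
  · rintro _ ⟨p, rfl⟩
    refine ⟨_, ⟨(graph (2 * N + 1)).realizationMap α.symm p, rfl⟩, ?_⟩
    rw [H]
    congr 1
    refine Subtype.ext (funext fun v => ?_)
    change p.1 (α (α.symm v)) = p.1 v
    rw [α.apply_symm_apply]

theorem exists_isInducedBy (H : IsAdmissible (2 * N + 1) a ψ₀) (hN : 2 ≤ N)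
    (α : graph (2 * N + 1) ≃g graph (2 * N + 1)) :
    ∃ h : Sphere3 ≃ₜ Sphere3,
      IsInducedBy (fun p : Space N => ribbonMap (2 * N + 1) a ψ₀ p) α h := by
  -- From 2 ≤ N there are at least five rungs, so α is a rotation or a reflection of the circle.
  obtain ⟨c, hα | hα⟩ := aut_eq (by omega) α
  · refine ⟨Sphere3.rotateHomeomorph (longitude (2 * N + 1) c) (Real.pi * a * c / (2 * N + 1 : ℕ)),
      isInducedBy_of_apply fun p => ?_⟩
    change Sphere3.rotate _ _ (ribbonMap _ _ _ p.1) = ribbonMap _ _ _ _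
    rcases exists_outerPoint_or_rungPoint H.two_le p with ⟨u, hp⟩ | ⟨k, t, ht, hp⟩
    · rw [realizationMap_outerPoint_of_rotation hα hp, hp, H.ribbonMap_outerPoint,
        H.ribbonMap_outerPoint, rotate_ribbonPoint H.n_pos]
    · rw [realizationMap_rungPoint_of_rotation hα hp, hp, H.ribbonMap_rungPoint,
        H.ribbonMap_rungPoint, rotate_ribbonPoint H.n_pos, Int.cast_add]
  · refine ⟨Sphere3.conjugateHomeomorph.trans (Sphere3.rotateHomeomorph (longitude (2 * N + 1) c)
      (twist (2 * N + 1) a c + twist (2 * N + 1) a 0)), isInducedBy_of_apply fun p => ?_⟩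
    change Sphere3.rotate _ _ (Sphere3.conjugate (ribbonMap _ _ _ p.1)) = ribbonMap _ _ _ _
    rcases exists_outerPoint_or_rungPoint H.two_le p with ⟨u, hp⟩ | ⟨k, t, ht, hp⟩
    · rw [realizationMap_outerPoint_of_reflection hα hp, hp, H.ribbonMap_outerPoint,
        H.ribbonMap_outerPoint, rotate_conjugate_ribbonPoint H.n_pos]
    · rw [realizationMap_rungPoint_of_reflection hα hp, hp, H.ribbonMap_rungPoint,
        H.ribbonMap_rungPoint, rotate_conjugate_ribbonPoint H.n_pos, Int.cast_sub]

end IsAdmissible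

end MobiusLadder

namespace MobiusLadder

/-! ### The generalized Simon invariant of the twisted ladder -/

theorem Edge.point_ne_of_isDisjoint {N : ℕ} {e e' : Edge N} (h : e.IsDisjoint e') {s t : ℝ}
    (hs : s ∈ Set.Icc (0 : ℝ) 1) (ht : t ∈ Set.Icc (0 : ℝ) 1) : e.point s ≠ e'.point t := by
  intro h0
  have h1 := congrArg Subtype.val h0
  rw [Edge.point_val _ hs, Edge.point_val _ ht] at h1
  have := mix_eq_mix e.adj.ne e'.adj.ne h1
  unfold Edge.IsDisjoint at h
  tauto

theorem isDisjoint_antipodal {N : ℕ} (hN : 1 ≤ N) {i j : Fin (2 * (2 * N + 1))}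
    (h : (j : ℕ) = i + (2 * N + 1)) : Edge.IsDisjoint (Sum.inl i : Edge N) (Sum.inl j) := by
  have key : ∀ c : ℤ, c ≠ 0 → |c| < 2 * (2 * N + 1 : ℕ) → (c : ZMod (2 * (2 * N + 1))) ≠ 0 :=
    fun c h0 h => intCast_ne_zero_of_abs_lt h0 h
  have k1 := key (2 * N + 1) (by omega) (by rw [abs_lt]; omega)
  have k2 := key (2 * N + 2) (by omega) (by rw [abs_lt]; omega)
  have k3 := key (2 * N) (by omega) (by rw [abs_lt]; omega)
  have hi : ((j : ℕ) : ZMod (2 * (2 * N + 1))) = (i : ℕ) + (2 * N + 1) := by rw [h]; push_cast; rfl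
  push_cast at k1 k2 k3
  unfold Edge.IsDisjoint Edge.src Edge.tgt
  dsimp only
  rw [hi]
  refine ⟨?_, ?_, ?_, ?_⟩ <;> split_ifs <;> intro h0 <;>
    first
    | exact k1 (by linear_combination -h0)
    | exact k2 (by linear_combination -h0)
    | exact k3 (by linear_combination -h0)

theorem cross_comm (v w : ℝ × ℝ) : cross w v = -cross v w := by
  unfold cross; ring

/-- The condition reads ai + 1/2 < nl < a(i + 1) + 1/2, which for integers means ai < nl ≤ a(i + 1).
The half-integral offset yields half-open intervals, which fit together without gaps or overlaps. -/
theorem setOf_mem_Ioo_of_pos {n : ℕ} (hn : 0 < n) {a : ℤ} (ha : 0 < a) (i : ℕ) :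
    {l : ℤ | ((2 * n * l - 1) / (2 * a) : ℝ) ∈ Set.Ioo (i : ℝ) (i + 1)} =
      ↑(Finset.Ioc (a * i / (n : ℤ)) (a * (i + 1 : ℕ) / (n : ℤ))) := by
  have hn' : (0 : ℤ) < n := by exact_mod_cast hn
  have ha' : (0 : ℝ) < 2 * a := by
    have : (0 : ℝ) < a := by exact_mod_cast ha
    linarith
  ext l
  rw [Set.mem_ofPred_eq, Set.mem_Ioo, lt_div_iff₀ ha', div_lt_iff₀ ha', Finset.coe_Ioc, Set.mem_Ioc,
    Int.ediv_lt_iff_lt_mul hn', Int.le_ediv_iff_mul_le hn']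
  have e1 : (i : ℝ) * (2 * a) < 2 * n * l - 1 ↔ (i : ℤ) * (2 * a) < 2 * n * l - 1 := by
    exact_mod_cast Iff.rfl
  have e2 : (2 * n * l - 1 : ℝ) < (i + 1) * (2 * a) ↔ 2 * n * l - 1 < ((i : ℤ) + 1) * (2 * a) := by
    exact_mod_cast Iff.rfl
  rw [e1, e2]
  push_cast
  constructor <;> rintro ⟨h1, h2⟩ <;> constructor
  · linarith
  · by_contra! h; linarith
  · have := Int.add_one_le_iff.2 h1; linarith
  · linarith

theorem setOf_mem_Ioo_of_neg {n : ℕ} (hn : 0 < n) {a : ℤ} (ha : a < 0) (i : ℕ) :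
    {l : ℤ | ((2 * n * l - 1) / (2 * a) : ℝ) ∈ Set.Ioo (i : ℝ) (i + 1)} =
      ↑(Finset.Ioc (a * (i + 1 : ℕ) / (n : ℤ)) (a * i / (n : ℤ))) := by
  have hn' : (0 : ℤ) < n := by exact_mod_cast hn
  have ha' : 2 * (a : ℝ) < 0 := by
    have : (a : ℝ) < 0 := by exact_mod_cast ha
    linarith
  ext l
  rw [Set.mem_ofPred_eq, Set.mem_Ioo, lt_div_iff_of_neg ha', div_lt_iff_of_neg ha', Finset.coe_Ioc,
    Set.mem_Ioc, Int.ediv_lt_iff_lt_mul hn', Int.le_ediv_iff_mul_le hn']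
  have e1 : 2 * n * l - 1 < (i : ℝ) * (2 * a) ↔ 2 * n * l - 1 < (i : ℤ) * (2 * a) := by
    exact_mod_cast Iff.rfl
  have e2 : (i + 1) * (2 * a) < (2 * n * l - 1 : ℝ) ↔ ((i : ℤ) + 1) * (2 * a) < 2 * n * l - 1 := by
    exact_mod_cast Iff.rfl
  rw [e1, e2]
  push_cast
  constructor <;> rintro ⟨h1, h2⟩ <;> constructor
  · linarith
  · by_contra! h; linarith
  · linarith
  · have := Int.add_one_le_iff.2 h1; linarith

theorem eq_add_of_position_eq {n i j : ℕ} {x y : ℝ} {l : ℤ} (hx : x ∈ Set.Ioo (i : ℝ) (i + 1))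
    (hy : y ∈ Set.Ioo (j : ℝ) (j + 1)) (hj : j < 2 * n) (hij : i < j)
    (hl : y = x + n + 2 * n * l) : j = i + n := by
  have e1 : (j : ℝ) < i + n + 2 * n * l + 1 := by linarith [hx.2, hy.1]
  have e2 : (i : ℝ) + n + 2 * n * l < j + 1 := by linarith [hx.1, hy.2]
  have e1' : (j : ℤ) < i + n + 2 * n * l + 1 := by exact_mod_cast e1
  have e2' : (i : ℤ) + n + 2 * n * l < j + 1 := by exact_mod_cast e2
  have hl0 : l = 0 := by
    by_contra h0
    rcases lt_or_gt_of_ne h0 with h0 | h0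
    · nlinarith
    · nlinarith
  rw [hl0] at e1' e2'
  omega

namespace IsAdmissible

variable {N : ℕ} {a : ℤ} {ψ₀ : ℝ}

theorem cast_pos_or_neg (H : IsAdmissible (2 * N + 1) a ψ₀) : 0 < a ∨ a < 0 := by
  have := H.odd
  grind

/-- All crossings of the projection have the same sign. -/
theorem crossingSign_antipodal (H : IsAdmissible (2 * N + 1) a ψ₀) {i j : Fin (2 * (2 * N + 1))}
    (hij : (j : ℕ) = i + (2 * N + 1)) {s t : ℝ} (hs : s ∈ Set.Ioo (0 : ℝ) 1)
    (ht : t ∈ Set.Ioo (0 : ℝ) 1)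
    (hc : Real.cos (twist (2 * N + 1) a (outerParam i s)) = 0)
    (hst : outerParam j t = outerParam i s + (2 * N + 1 : ℕ)) :
    crossingSign (fun p : Space N => ribbonMap (2 * N + 1) a ψ₀ p) (Sum.inl i) (Sum.inl j) (s, t) =
      a.sign := by
  -- The number of rungs is odd, so antipodal edges have indices of opposite parity and run in
  -- opposite directions around the circle.
  have hpar : (if Even (i : ℕ) then 1 else -1 : ℝ) * (if Even (j : ℕ) then 1 else -1) = -1 := by
    rw [hij]
    by_cases h : Even (i : ℕ)
    · have : ¬ Even ((i : ℕ) + (2 * N + 1)) := by grind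
      simp [h, this]
    · have : Even ((i : ℕ) + (2 * N + 1)) := by grind
      simp [h, this]
  have hc' : Real.cos (twist (2 * N + 1) a (outerParam i s + (2 * N + 1 : ℕ))) = 0 := by
    rw [cos_twist_add_half H.n_pos H.odd, hc, neg_zero]
  have hK : 0 < 4 * Real.pi ^ 2 / (2 * N + 1 : ℕ) ^ 2 * Real.cos ψ₀ ^ 2 * Real.sin ψ₀ := by
    have := Real.pi_pos
    have := H.cos_pos H.self_mem
    have := H.sin_pos
    positivity
  have hS := H.sin_pos
  have hne := sin_twist_ne_zero hc
  have hs' := Set.Ioo_subset_Icc_self hs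
  have ht' := Set.Ioo_subset_Icc_self ht
  simp only [crossingSign]
  rw [cross_comm (deriv _ s), H.edgeHeight_inl i hs', H.edgeHeight_inl j ht', hst,
    H.deriv_edgeShadow_inl i hs, H.deriv_edgeShadow_inl j ht, cross_smul, hst, hpar,
    cross_boundaryVelocity H.n_pos H.odd hc, height_of_cos_twist_eq_zero hc,
    height_of_cos_twist_eq_zero hc', sin_twist_add_half H.n_pos H.odd]
  generalize 4 * Real.pi ^ 2 / (2 * N + 1 : ℕ) ^ 2 * Real.cos ψ₀ ^ 2 * Real.sin ψ₀ = K at *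
  generalize Real.sin (twist (2 * N + 1) a (outerParam i s)) = σ at *
  generalize Real.sin ψ₀ = S at *
  have main : ∀ x : ℝ, 0 < x → ((SignType.sign (x * a) : SignType) : ℤ) = a.sign := by
    intro x hx
    rcases H.cast_pos_or_neg with ha | ha
    · rw [sign_pos (mul_pos hx (by exact_mod_cast ha)), Int.sign_eq_one_of_pos ha]; rfl
    · rw [sign_neg (mul_neg_of_pos_of_neg hx (by exact_mod_cast ha)), Int.sign_eq_neg_one_of_neg ha]
      rfl
  -- The sign of σ decides both which strand is on top and the sign of the cross product; the two
  -- effects cancel.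
  rcases lt_or_gt_of_ne hne with h | h
  · rw [if_neg (by nlinarith)]
    rw [← main (K * -σ) (mul_pos hK (by linarith))]
    congr 2
    ring
  · rw [if_pos (by nlinarith)]
    rw [← main (K * σ) (mul_pos hK h)]
    congr 2
    ring

theorem crossings_eq (H : IsAdmissible (2 * N + 1) a ψ₀) {i j : Fin (2 * (2 * N + 1))}
    (hij : (j : ℕ) = i + (2 * N + 1)) :
    crossings (fun p : Space N => ribbonMap (2 * N + 1) a ψ₀ p) (Sum.inl i) (Sum.inl j) =
      {st | st.1 ∈ Set.Ioo (0 : ℝ) 1 ∧ st.2 = 1 - st.1 ∧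
        Real.cos (twist (2 * N + 1) a (outerParam i st.1)) = 0} := by
  have hN : 1 ≤ N := by have := H.two_le; omega
  have hpar : ∀ s, outerParam j (1 - s) = outerParam i s + (2 * N + 1 : ℕ) := by
    intro s
    unfold outerParam
    rw [hij]
    by_cases h : Even (i : ℕ)
    · have : ¬ Even ((i : ℕ) + (2 * N + 1)) := by grind
      simp only [h, this, if_true, if_false]
      push_cast; ring
    · have : Even ((i : ℕ) + (2 * N + 1)) := by grind
      simp only [h, this, if_true, if_false]
      push_cast; ring
  ext ⟨s, t⟩
  simp only [crossings, Set.mem_ofPred_eq]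
  constructor
  · rintro ⟨hs, ht, h⟩
    obtain ⟨i', j', hi, hj, hc, l, hl⟩ := H.crossing_edges hs ht
      (Edge.point_ne_of_isDisjoint (isDisjoint_antipodal hN hij) (Set.Ioo_subset_Icc_self hs)
        (Set.Ioo_subset_Icc_self ht)) h
    obtain rfl := Sum.inl_injective hi
    obtain rfl := Sum.inl_injective hj
    refine ⟨hs, ?_, hc⟩
    have b1 := outerParam_mem_Ioo i hs
    have b2 := outerParam_mem_Ioo j ht
    have hjr : ((j : ℕ) : ℝ) = (i : ℕ) + (2 * N + 1 : ℕ) := by rw [hij]; push_cast; rfl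
    have hl0 : l = 0 := by
      have e1 : (-1 : ℝ) < 2 * (2 * N + 1 : ℕ) * l := by linarith [b1.2, b2.1]
      have e2 : 2 * (2 * N + 1 : ℕ) * l < (1 : ℝ) := by linarith [b1.1, b2.2]
      have e1' : (-1 : ℤ) < 2 * (2 * N + 1 : ℕ) * l := by exact_mod_cast e1
      have e2' : 2 * (2 * N + 1 : ℕ) * l < (1 : ℤ) := by exact_mod_cast e2
      have : 2 * ((2 * N + 1 : ℕ) : ℤ) * l = 0 := by omega
      rcases mul_eq_zero.1 this with h | h
      · omega
      · exact h
    rw [hl0] at hl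
    have h1 := hpar (1 - t)
    have h2 := hpar s
    have h3 : outerParam j t = outerParam j (1 - s) := by rw [hl, h2]; simp
    unfold outerParam at h3
    split_ifs at h3 <;> linarith
  · rintro ⟨hs, rfl, hc⟩
    have ht : 1 - s ∈ Set.Ioo (0 : ℝ) 1 := ⟨by linarith [hs.2], by linarith [hs.1]⟩
    refine ⟨hs, ht, ?_⟩
    rw [H.edgeShadow_inl i (Set.Ioo_subset_Icc_self hs),
      H.edgeShadow_inl j (Set.Ioo_subset_Icc_self ht), hpar, ribbonPoint_add_half H.n_pos H.odd,
      shadow_ribbonPoint, shadow_ribbonPoint, ribbonRadius, ribbonRadius, hc, Real.cos_neg]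
    simp

theorem signedCrossings_antipodal (H : IsAdmissible (2 * N + 1) a ψ₀)
    {i j : Fin (2 * (2 * N + 1))} (hij : (j : ℕ) = i + (2 * N + 1)) :
    signedCrossings (fun p : Space N => ribbonMap (2 * N + 1) a ψ₀ p) (Sum.inl i) (Sum.inl j) =
      a * ((i : ℕ) + 1 : ℕ) / (2 * N + 1 : ℕ) - a * (i : ℕ) / (2 * N + 1 : ℕ) := by
  have ha := H.cast_ne_zero
  have hn : (0 : ℤ) < (2 * N + 1 : ℕ) := by positivity
  have hcs := H.crossings_eq hij
  -- the crossings correspond to the multiples of `n` between `a * i` and `a * (i + 1)`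
  let u : ℤ → ℝ := fun l => (2 * (2 * N + 1 : ℕ) * l - 1) / (2 * a)
  -- Here `u l` solves the crossing equation 2au + 1 = 2nl, and `g l` is its parameter on the
  -- oriented edge.
  let g : ℤ → ℝ := fun l => if Even (i : ℕ) then u l - (i : ℕ) else (i : ℕ) + 1 - u l
  have hg : ∀ l, outerParam i (g l) = u l := by
    intro l
    simp only [outerParam, g]
    split_ifs <;> ring
  have hgI : ∀ l, g l ∈ Set.Ioo (0 : ℝ) 1 ↔ u l ∈ Set.Ioo ((i : ℕ) : ℝ) ((i : ℕ) + 1) := by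
    intro l
    simp only [g, Set.mem_Ioo]
    split_ifs <;> constructor <;> rintro ⟨h1, h2⟩ <;> constructor <;> linarith
  have hu_inj : Function.Injective u := by
    intro l l' h
    have hn' : ((2 * N + 1 : ℕ) : ℝ) ≠ 0 := by positivity
    simp only [u] at h
    rw [div_left_inj' (by positivity)] at h
    have : (l : ℝ) = l' := by
      apply mul_left_cancel₀ hn'
      linarith
    exact_mod_cast this
  have hg_inj : Function.Injective fun l => (g l, 1 - g l) := by
    intro l l' h
    have h1 : g l = g l' := congrArg Prod.fst h
    apply hu_inj
    rw [← hg, ← hg, h1]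
  have himage : crossings (fun p : Space N => ribbonMap (2 * N + 1) a ψ₀ p) (Sum.inl i)
      (Sum.inl j) = (fun l => (g l, 1 - g l)) '' {l | u l ∈ Set.Ioo ((i : ℕ) : ℝ) ((i : ℕ) + 1)} := by
    rw [hcs]
    ext ⟨s, t⟩
    simp only [Set.mem_ofPred_eq, Set.mem_image, Prod.mk.injEq]
    constructor
    · rintro ⟨hs, rfl, hc⟩
      obtain ⟨l, hl⟩ := (cos_twist_eq_zero_iff H.n_pos).1 hc
      have hul : u l = outerParam i s := by
        simp only [u]
        rw [div_eq_iff (by positivity)]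
        linarith
      have hgs : g l = s := by
        have := (hg l).trans hul
        unfold outerParam at this
        split_ifs at this <;> linarith
      exact ⟨l, by rw [hul]; exact outerParam_mem_Ioo i hs, hgs, by rw [hgs]⟩
    · rintro ⟨l, hl, rfl, rfl⟩
      refine ⟨(hgI l).2 hl, rfl, ?_⟩
      rw [hg, cos_twist_eq_zero_iff H.n_pos]
      exact ⟨l, by simp only [u]; field_simp; ring⟩
  have hsign : ∀ st ∈ crossings (fun p : Space N => ribbonMap (2 * N + 1) a ψ₀ p) (Sum.inl i)
      (Sum.inl j), crossingSign (fun p : Space N => ribbonMap (2 * N + 1) a ψ₀ p) (Sum.inl i)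
      (Sum.inl j) st = a.sign := by
    rintro ⟨s, t⟩ hst
    rw [hcs] at hst
    obtain ⟨hs, ht, hc⟩ := hst
    dsimp only at hs ht hc
    subst ht
    refine H.crossingSign_antipodal hij hs ⟨by linarith [hs.2], by linarith [hs.1]⟩ hc ?_
    unfold outerParam
    rw [hij]
    by_cases h : Even (i : ℕ)
    · have : ¬ Even ((i : ℕ) + (2 * N + 1)) := by grind
      simp only [h, this, if_true, if_false]
      push_cast; ring
    · have : Even ((i : ℕ) + (2 * N + 1)) := by grind
      simp only [h, this, if_true, if_false]
      push_cast; ring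
  rw [signedCrossings, finsum_mem_congr rfl hsign, himage, finsum_mem_image hg_inj.injOn]
  -- For negative a the floors decrease, and the common sign -1 turns the count back into the same
  -- difference.
  rcases H.cast_pos_or_neg with hpos | hneg
  · rw [setOf_mem_Ioo_of_pos H.n_pos hpos, finsum_mem_coe_finset, Finset.sum_const, Int.card_Ioc,
      Int.sign_eq_one_of_pos hpos, nsmul_one, Int.natCast_toNat_eq_self.2]
    exact sub_nonneg.2 (Int.ediv_le_ediv hn (by push_cast; linarith))
  · rw [setOf_mem_Ioo_of_neg H.n_pos hneg, finsum_mem_coe_finset, Finset.sum_const, Int.card_Ioc,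
      Int.sign_eq_neg_one_of_neg hneg, nsmul_eq_mul, Int.natCast_toNat_eq_self.2]
    · ring
    · exact sub_nonneg.2 (Int.ediv_le_ediv hn (by push_cast; linarith))

/-- By `crossing_edges` a crossing needs outer edges half a turn apart; the index order selects
which of the two is the later one. -/
theorem signedCrossings_eq_zero (H : IsAdmissible (2 * N + 1) a ψ₀) {e e' : Edge N}
    (hd : e.IsDisjoint e') (hlt : e.index < e'.index)
    (hne : ∀ i j, e = Sum.inl i → e' = Sum.inl j → (j : ℕ) ≠ i + (2 * N + 1)) :
    signedCrossings (fun p : Space N => ribbonMap (2 * N + 1) a ψ₀ p) e e' = 0 := by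
  have : crossings (fun p : Space N => ribbonMap (2 * N + 1) a ψ₀ p) e e' = ∅ := by
    rw [Set.eq_empty_iff_forall_notMem]
    rintro ⟨s, t⟩ ⟨hs, ht, h⟩
    obtain ⟨i, j, rfl, rfl, -, l, hl⟩ := H.crossing_edges hs ht
      (Edge.point_ne_of_isDisjoint hd (Set.Ioo_subset_Icc_self hs)
        (Set.Ioo_subset_Icc_self ht)) h
    refine hne i j rfl rfl ?_
    exact eq_add_of_position_eq (outerParam_mem_Ioo i hs) (outerParam_mem_Ioo j ht) j.2 hlt hl
  rw [signedCrossings, this, finsum_mem_empty]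

theorem simonInvariant_eq (H : IsAdmissible (2 * N + 1) a ψ₀) :
    simonInvariant (fun p : Space N => ribbonMap (2 * N + 1) a ψ₀ p) = -a := by
  have hN : 1 ≤ N := by have := H.two_le; omega
  let F : Fin (2 * N + 1) → Edge N × Edge N := fun i =>
    (Sum.inl ⟨i, by omega⟩, Sum.inl ⟨i + (2 * N + 1), by omega⟩)
  -- The floors telescope to an / n - 0, where the division is exact.
  have key : ∑ i : Fin (2 * N + 1), -(a * ((i : ℕ) + 1 : ℕ) / (2 * N + 1 : ℕ)
      - a * (i : ℕ) / (2 * N + 1 : ℕ)) = -a := by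
    rw [Finset.sum_neg_distrib, Fin.sum_univ_eq_sum_range
      (fun i => a * (i + 1 : ℕ) / (2 * N + 1 : ℕ) - a * (i : ℕ) / (2 * N + 1 : ℕ)),
      Finset.sum_range_sub fun i => a * (i : ℕ) / (2 * N + 1 : ℕ)]
    rw [Int.mul_ediv_cancel _ (by positivity)]
    simp
  rw [← key, simonInvariant]
  symm
  refine Finset.sum_of_injOn F ?_ ?_ ?_ ?_
  · intro i _ j _ h
    have h1 := Sum.inl_injective (congrArg Prod.fst h)
    exact Fin.ext (by simpa using h1)
  · intro i _
    simp only [Finset.coe_filter, Set.mem_ofPred_eq, F, Finset.mem_univ, true_and]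
    refine ⟨?_, isDisjoint_antipodal hN rfl⟩
    simp only [Edge.index]
    omega
  · rintro ⟨e, e'⟩ h hni
    simp only [Finset.mem_filter, Finset.mem_univ, true_and] at h
    rw [H.signedCrossings_eq_zero h.2 h.1, mul_zero]
    rintro i j rfl rfl hij
    refine hni ⟨⟨i, by omega⟩, by simp, ?_⟩
    simp only [F]
    congr 2
    exact Fin.ext hij.symm
  · intro i _
    simp only [F]
    rw [epsilon_antipodal rfl, H.signedCrossings_antipodal rfl]
    ring

end IsAdmissible

end MobiusLadder

theorem theorem3p10 (N : ℕ) (hN : 2 ≤ N) (m : ℤ) (hm : Odd m) :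
    ∃ f : MobiusLadder.Space N → Sphere3,
      Topology.IsEmbedding f ∧
      MobiusLadder.HasRegularProjection f ∧
      MobiusLadder.simonInvariant f = m ∧
      ∀ α : MobiusLadder.graph (2 * N + 1) ≃g MobiusLadder.graph (2 * N + 1),
        ∃ h : Sphere3 ≃ₜ Sphere3, MobiusLadder.IsInducedBy f α h := by
  -- The number of half twists is -m because the antipodal coefficient is -1.
  obtain ⟨ψ₀, H⟩ := MobiusLadder.exists_isAdmissible (n := 2 * N + 1) (by omega) hm.neg
  exact ⟨fun p => MobiusLadder.ribbonMap (2 * N + 1) (-m) ψ₀ p, H.isEmbedding,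
    H.hasRegularProjection, by rw [H.simonInvariant_eq, neg_neg], H.exists_isInducedBy hN⟩
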